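/- There is a universal constant $C>0$ such that the following holds. Let $N\ge 0$, $k\ge 1$ and $M_1,\dots,M_k\ge 0$ be integers, $M:=\sum_{i=1}^k M_i$ and $m:=\min_{1\le i\le k}M_i$. Let $Q\subset\mathbb{R}^N$ be a non-empty subset of the closed Euclidean unit ball, and let $E=E_1\times\cdots\times E_k\subset\mathbb{R}^M$, where each $E_i\subset\mathbb{R}^{M_i}$ is non-empty and has permutation symmetry, i.e. for every permutation $\pi$ of $\{1,\dots,M_i\}$ and every $x\in\mathbb{R}^{M_i}$, $(x_1,\dots,x_{M_i})\in E_i$ if and only if $(x_{\pi(1)},\dots,x_{\pi(M_i)})\in E_i$. Let $A\in\mathbb{R}^{M\times N}$ be a random matrix with independent standard normal entries, and for $q\in[2,\infty]$ let $$\mathcal{M}_q(A):=\inf_{\sigma\in Q}\,\inf_{y\in E}\,\|A\sigma-y\|_{q}$$ be the $\ell^q$-margin, where $\|\cdot\|_q$ is the $\ell^q$ norm on $\mathbb{R}^M$. Then for every $q\in[2,\infty]$ the random variable $\mathcal{M}_q(A)$ is square-integrable and $$\operatorname{Var}\big(\mathcal{M}_q(A)\big)\le C\left(1+\frac12\log\left(\frac{m^{1-2/q}}{k}\vee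 1\right)\right)^{-1},$$ where $2/q:=0$ for $q=\infty$ and $a\vee b:=\max(a,b)$. -/

import Mathlib

open MeasureTheory ProbabilityTheory
open scoped ENNReal Matrix

/-- A set `E ⊆ ℝ^ι` has permutation symmetry: membership is unaffected by permuting coordinates. -/
def HasPermSymmetry {ι : Type*} (E : Set (ι → ℝ)) : Prop :=
  ∀ (π : Equiv.Perm ι) (x : ι → ℝ), x ∈ E ↔ (fun i => x (π i)) ∈ E

/-- The `ℓ^q` distance from the point `x` to the set `E`
(the norm of `WithLp.toLp q` is the `ℓ^q` norm; it is the sup norm for `q = ∞`). -/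
noncomputable def lqDist {ι : Type*} [Fintype ι] (q : ℝ≥0∞) (x : ι → ℝ) (E : Set (ι → ℝ)) : ℝ :=
  ⨅ y : E, ‖WithLp.toLp q (x - (y : ι → ℝ))‖

/-- The `ℓ^q`-margin of the matrix `A` for the feasible set `Q` and the constraint set `E`:
the infimum over `σ ∈ Q` of the `ℓ^q` distance from `A σ` to `E`. -/
noncomputable def lqMargin {ι κ : Type*} [Fintype ι] [Fintype κ] (q : ℝ≥0∞)
    (Q : Set (EuclideanSpace ℝ κ)) (E : Set (ι → ℝ)) (A : Matrix ι κ ℝ) : ℝ :=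
  ⨅ σ : Q, lqDist q (A *ᵥ (WithLp.ofLp (σ : EuclideanSpace ℝ κ))) E

/-- The product `E_1 × ⋯ × E_k ⊆ ℝ^{M_1 + ⋯ + M_k}`, where the coordinates of `ℝ^{M_1 + ⋯ + M_k}`
are labelled by pairs (block `i`, position `a` within block `i`). -/
def blockProd {k : ℕ} {M : Fin k → ℕ} (E : (i : Fin k) → Set (Fin (M i) → ℝ)) :
    Set ((Σ i : Fin k, Fin (M i)) → ℝ) :=
  {x | ∀ i : Fin k, (fun a : Fin (M i) => x ⟨i, a⟩) ∈ E i}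

/-- The entries of the random matrix `A` are independent standard normal random variables. -/
def IsStdGaussianMatrix {Ω : Type*} [MeasurableSpace Ω] {ι κ : Type*}
    (A : Ω → Matrix ι κ ℝ) (P : Measure Ω) : Prop :=
  (∀ (i : ι) (j : κ), HasLaw (fun ω => A ω i j) (gaussianReal 0 1) P) ∧
    iIndepFun (fun (p : ι × κ) (ω : Ω) => A ω p.1 p.2) P

/-! ### Log-Sobolev and Falik–Samorodnitsky inequalities on the discrete cube. -/

section Cube

/-! The Poincaré inequality alone gives a variance of order one, since the margin is a 1-Lipschitz
function of the Gaussian entries. The logarithmic gain is superconcentration: an `L¹`–`L²`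
inequality improves on Poincaré when every coordinate has small `L¹` influence. Its linearised form,
for every real `K`, is `K Var F ≤ 4 E|DF|² + exp (K - 1) ∑ₚ (E|DₚF|)²`.

The influences are small by symmetry. Perturbing the rows of block `b` by vectors of norm at most
one moves the margin by at most `c_b = M_b^(1/q)`, so the row norms of the gradient over that block
sum to at most `c_b`. Rows of a block are exchangeable, hence each has mean gradient norm at most
`c_b / M_b`. Summing squares gives at most `∑_b M_b^(2/q - 1) ≤ k / m^(1 - 2/q)`, and `K = 1 + log
Y` with `Y = max (m^(1 - 2/q) / k) 1` makes `exp (K - 1)` times the influence sum at most one.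

The functional inequality is proved on the cube (`cube_variance_le`) and carried to Gaussian space
by the central limit theorem (`gaussian_variance_le`). Truncation and radial mollification reduce
the margin to bounded functions with Lipschitz derivative while keeping the slope bounds and the row
symmetry (`BlockLipschitz.variance_le`). The influence estimate is
`BlockLipschitz.sum_sq_cubeMean_le`, and `blockLipschitz_lqMargin` puts the margin in this
framework. -/

/-- The discrete derivative of a function on the cube in the direction `p`. -/
noncomputable def cubeDiff {α : Type*} [DecidableEq α] (F : (α → Bool) → ℝ) (p : α)
    (x : α → Bool) : ℝ :=
  (F (Function.update x p true) - F (Function.update x p false)) / 2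

/-- The mean of a function on the cube. -/
noncomputable def cubeMean {α : Type*} [Fintype α] [DecidableEq α] (F : (α → Bool) → ℝ) : ℝ :=
  (∑ x, F x) / 2 ^ Fintype.card α

namespace cubeMean

variable {α : Type*} [Fintype α] [DecidableEq α]

lemma add (F G : (α → Bool) → ℝ) :
    cubeMean (fun x => F x + G x) = cubeMean F + cubeMean G := by
  simp only [cubeMean, Finset.sum_add_distrib, add_div]

lemma sub (F G : (α → Bool) → ℝ) :
    cubeMean (fun x => F x - G x) = cubeMean F - cubeMean G := by
  simp only [cubeMean, Finset.sum_sub_distrib, sub_div]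

lemma const_mul (c : ℝ) (F : (α → Bool) → ℝ) :
    cubeMean (fun x => c * F x) = c * cubeMean F := by
  simp only [cubeMean, ← Finset.mul_sum, mul_div_assoc]

lemma div_const (F : (α → Bool) → ℝ) (c : ℝ) :
    cubeMean (fun x => F x / c) = cubeMean F / c := by
  simp only [cubeMean, ← Finset.sum_div]
  ring

lemma const (c : ℝ) : cubeMean (fun _ : α → Bool => c) = c := by
  simp [cubeMean]

lemma sum {β : Type*} (s : Finset β) (F : β → (α → Bool) → ℝ) :
    cubeMean (fun x => ∑ b ∈ s, F b x) = ∑ b ∈ s, cubeMean (F b) := by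
  simp only [cubeMean, ← Finset.sum_div]
  rw [Finset.sum_comm]

lemma mono {F G : (α → Bool) → ℝ} (h : ∀ x, F x ≤ G x) : cubeMean F ≤ cubeMean G := by
  unfold cubeMean
  gcongr with x
  exact h x

lemma nonneg {F : (α → Bool) → ℝ} (h : ∀ x, 0 ≤ F x) : 0 ≤ cubeMean F := by
  simpa [const] using mono (F := fun _ => 0) h

lemma congr_equiv {β : Type*} [Fintype β] [DecidableEq β] (e : α ≃ β) (F : (β → Bool) → ℝ) :
    cubeMean (fun x : α → Bool => F (x ∘ e.symm)) = cubeMean F := by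
  unfold cubeMean
  rw [Fintype.card_congr e]
  congr 1
  exact Fintype.sum_equiv (e.arrowCongr (Equiv.refl Bool)) _ _ fun x => rfl

/-- The second moment dominates the square of the mean. -/
lemma sq_le (F : (α → Bool) → ℝ) : cubeMean F ^ 2 ≤ cubeMean (fun x => F x ^ 2) := by
  have h : 0 ≤ cubeMean (fun x => (F x - cubeMean F) ^ 2) := nonneg fun x => sq_nonneg _
  have e : (fun x => (F x - cubeMean F) ^ 2)
      = fun x => F x ^ 2 - (2 * cubeMean F * F x - cubeMean F ^ 2) := by
    funext x; ring
  rw [e, sub, sub, const_mul, const] at h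
  nlinarith

lemma cons {n : ℕ} (F : (Fin (n + 1) → Bool) → ℝ) :
    cubeMean F
      = cubeMean (fun y => (F (Fin.cons true y) + F (Fin.cons false y)) / 2) := by
  unfold cubeMean
  rw [← (Fin.consEquiv fun _ => Bool).sum_comp, Fintype.sum_prod_type, Fintype.sum_bool,
    ← Finset.sum_add_distrib, ← Finset.sum_div]
  simp only [Fintype.card_fin, pow_succ]
  field_simp
  rfl

end cubeMean

lemma cubeDiff_cons_succ {n : ℕ} (F : (Fin (n + 1) → Bool) → ℝ) (p : Fin n) (b : Bool)
    (y : Fin n → Bool) :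
    cubeDiff F p.succ (Fin.cons b y) = cubeDiff (fun z => F (Fin.cons b z)) p y := by
  simp only [cubeDiff, Fin.cons_update]

lemma cubeDiff_cons_zero {n : ℕ} (F : (Fin (n + 1) → Bool) → ℝ) (b : Bool)
    (y : Fin n → Bool) :
    cubeDiff F 0 (Fin.cons b y) = (F (Fin.cons true y) - F (Fin.cons false y)) / 2 := by
  simp only [cubeDiff, Fin.update_cons_zero]

/-- A logarithmic Sobolev inequality on the two-point space. -/
lemma two_point_log_sobolev (a b : ℝ) :
    (a ^ 2 * Real.log (a ^ 2) + b ^ 2 * Real.log (b ^ 2)) / 2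
      ≤ (a ^ 2 + b ^ 2) / 2 * Real.log ((a ^ 2 + b ^ 2) / 2) + (a - b) ^ 2 := by
  wlog hab : 0 ≤ a ∧ 0 ≤ b generalizing a b
  · have h := this |a| |b| ⟨abs_nonneg a, abs_nonneg b⟩
    simp only [sq_abs] at h
    have h2 : (|a| - |b|) ^ 2 ≤ (a - b) ^ 2 := sq_le_sq.2 (abs_abs_sub_abs_le_abs_sub a b)
    linarith
  obtain ⟨ha, hb⟩ := hab
  set s := (a ^ 2 + b ^ 2) / 2 with hs
  by_cases h0 : s = 0
  · have ha0 : a = 0 := by nlinarith [sq_nonneg a, sq_nonneg b]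
    have hb0 : b = 0 := by nlinarith [sq_nonneg a, sq_nonneg b]
    simp [ha0, hb0, hs]
  have hs0 : 0 < s := lt_of_le_of_ne (by positivity) (Ne.symm h0)
  -- Linearising the logarithm at the mean `s` bounds the entropy by the variance of the squares
  -- divided by `s`, namely `(a - b)² (a + b)² / (4 s)`, and `(a + b)² / 4 ≤ s`. The constant is not
  -- sharp.
  have key : ∀ t : ℝ, 0 ≤ t → t * Real.log t ≤ t * Real.log s + t * (t / s - 1) := by
    intro t ht
    rcases ht.eq_or_lt with rfl | ht
    · simp
    have := Real.log_le_sub_one_of_pos (div_pos ht hs0)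
    rw [Real.log_div ht.ne' hs0.ne'] at this
    nlinarith
  have h1 := key (a ^ 2) (sq_nonneg a)
  have h2 := key (b ^ 2) (sq_nonneg b)
  have h3 : (a ^ 2 * (a ^ 2 / s - 1) + b ^ 2 * (b ^ 2 / s - 1)) / 2 ≤ (a - b) ^ 2 := by
    have e : (a ^ 2 * (a ^ 2 / s - 1) + b ^ 2 * (b ^ 2 / s - 1)) / 2
        = ((a - b) ^ 2 * ((a + b) ^ 2 / 4)) / s := by
      field_simp
      rw [hs]; ring
    rw [e, div_le_iff₀ hs0]
    have : (a + b) ^ 2 / 4 ≤ s := by nlinarith [sq_nonneg (a - b)]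
    exact mul_le_mul_of_nonneg_left this (sq_nonneg _)
  have e2 : (a ^ 2 * Real.log s + b ^ 2 * Real.log s) / 2 = s * Real.log s := by rw [hs]; ring
  linarith

/-- Reverse triangle inequality for the normalised Euclidean norm on the plane. It ensures that
taking the quadratic mean over one coordinate does not increase the energy in the others. -/
lemma sq_sub_sqrt_le (a b c d : ℝ) :
    (√((a ^ 2 + b ^ 2) / 2) - √((c ^ 2 + d ^ 2) / 2)) ^ 2
      ≤ ((a - c) ^ 2 + (b - d) ^ 2) / 2 := by
  have h1 : √((a ^ 2 + b ^ 2) / 2) ^ 2 = (a ^ 2 + b ^ 2) / 2 := Real.sq_sqrt (by positivity)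
  have h2 : √((c ^ 2 + d ^ 2) / 2) ^ 2 = (c ^ 2 + d ^ 2) / 2 := Real.sq_sqrt (by positivity)
  have h3 : (a * c + b * d) / 2 ≤ √((a ^ 2 + b ^ 2) / 2) * √((c ^ 2 + d ^ 2) / 2) := by
    rw [← Real.sqrt_mul (by positivity)]
    apply Real.le_sqrt_of_sq_le
    nlinarith [sq_nonneg (a * d - b * c)]
  nlinarith

/-- The logarithmic Sobolev inequality on the discrete cube. -/
theorem cube_log_sobolev : ∀ {n : ℕ} (g : (Fin n → Bool) → ℝ),
    cubeMean (fun x => g x ^ 2 * Real.log (g x ^ 2))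
      ≤ cubeMean (fun x => g x ^ 2) * Real.log (cubeMean fun x => g x ^ 2)
        + 4 * ∑ p, cubeMean (fun x => cubeDiff g p x ^ 2)
  | 0, g => by simp [cubeMean]
  | n + 1, g => by
    set a : (Fin n → Bool) → ℝ := fun y => g (Fin.cons true y) with ha
    set b : (Fin n → Bool) → ℝ := fun y => g (Fin.cons false y) with hb
    -- Tensorisation: the entropy splits into the two-point entropy in the first coordinate and the
    -- entropy of the quadratic mean over that coordinate.
    have ih := cube_log_sobolev fun y => √((a y ^ 2 + b y ^ 2) / 2)
    have hsq : ∀ y, √((a y ^ 2 + b y ^ 2) / 2) ^ 2 = (a y ^ 2 + b y ^ 2) / 2 := fun y =>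
      Real.sq_sqrt (by positivity)
    simp only [hsq] at ih
    rw [cubeMean.cons, cubeMean.cons (fun x => g x ^ 2), Fin.sum_univ_succ]
    have h0 : cubeMean (fun x => cubeDiff g 0 x ^ 2)
        = cubeMean (fun y => (a y - b y) ^ 2) / 4 := by
      rw [cubeMean.cons, ← cubeMean.div_const]
      congr 1; funext y
      simp only [cubeDiff_cons_zero, ha, hb]; ring
    have hp : ∀ p : Fin n,
        cubeMean (fun y => cubeDiff (fun y => √((a y ^ 2 + b y ^ 2) / 2)) p y ^ 2)
          ≤ cubeMean (fun x => cubeDiff g p.succ x ^ 2) := by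
      intro p
      rw [cubeMean.cons (fun x => cubeDiff g p.succ x ^ 2)]
      refine cubeMean.mono fun y => ?_
      simp only [cubeDiff_cons_succ]
      have := sq_sub_sqrt_le (a (Function.update y p true)) (b (Function.update y p true))
        (a (Function.update y p false)) (b (Function.update y p false))
      simp only [cubeDiff, ha, hb] at this ⊢
      rw [div_pow, div_pow, div_pow]
      linarith
    have hsum := Finset.sum_le_sum fun p (_ : p ∈ Finset.univ) => hp p
    have h2 : cubeMean (fun y => (a y ^ 2 * Real.log (a y ^ 2) + b y ^ 2 * Real.log (b y ^ 2)) / 2)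
        ≤ cubeMean (fun y => (a y ^ 2 + b y ^ 2) / 2 * Real.log ((a y ^ 2 + b y ^ 2) / 2))
          + cubeMean (fun y => (a y - b y) ^ 2) := by
      rw [← cubeMean.add]
      exact cubeMean.mono fun y => two_point_log_sobolev _ _
    rw [h0]
    linarith

/-- The second moment is controlled by the energy and the first absolute moment. -/
theorem cube_sq_le_energy_add {n : ℕ} (g : (Fin n → Bool) → ℝ) (K : ℝ) :
    K * cubeMean (fun x => g x ^ 2)
      ≤ 4 * ∑ p, cubeMean (fun x => cubeDiff g p x ^ 2)
        + Real.exp (K - 1) * cubeMean (fun x => |g x|) ^ 2 := by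
  set A := cubeMean (fun x => g x ^ 2) with hA
  set B := cubeMean (fun x => |g x|) with hB
  have hAnn : 0 ≤ A := cubeMean.nonneg fun x => sq_nonneg _
  have hBnn : 0 ≤ B := cubeMean.nonneg fun x => abs_nonneg _
  have hD : 0 ≤ ∑ p, cubeMean (fun x => cubeDiff g p x ^ 2) :=
    Finset.sum_nonneg fun p _ => cubeMean.nonneg fun x => sq_nonneg _
  rcases hAnn.eq_or_lt with h0 | hApos
  · rw [← h0]
    have := Real.exp_pos (K - 1)
    have := mul_nonneg this.le (sq_nonneg B)
    linarith
  have hBpos : 0 < B := by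
    rcases hBnn.eq_or_lt with h | h
    · exfalso
      have hz : ∀ x, g x = 0 := by
        intro x
        have h' : ∑ x, |g x| = 0 := by
          have : (∑ x, |g x|) / 2 ^ Fintype.card (Fin n) = 0 := h.symm
          simpa using this
        simpa using (Finset.sum_eq_zero_iff_of_nonneg fun x _ => abs_nonneg (g x)).1 h' x
          (Finset.mem_univ x)
      simp [hA, hz, cubeMean] at hApos
    · exact h
  have hlsi := cube_log_sobolev g
  have hc : 0 < A / B := div_pos hApos hBpos
  -- The bound `log u ≤ u - 1` at `u = (A / B) / |g x|`. With the ratio `A / B` the last two terms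
  -- cancel on averaging, so the entropy of `g²` is at least `A log (A / B²)`.
  have pt : ∀ x, 2 * (g x ^ 2 * Real.log (A / B)) + 2 * g x ^ 2 - 2 * (A / B) * |g x|
      ≤ g x ^ 2 * Real.log (g x ^ 2) := by
    intro x
    by_cases hx : g x = 0
    · simp [hx]
    have hx' : 0 < |g x| := abs_pos.2 hx
    have h := Real.log_le_sub_one_of_pos (div_pos hc hx')
    rw [Real.log_div hc.ne' hx'.ne', Real.log_abs] at h
    rw [Real.log_pow]
    have h2 := mul_le_mul_of_nonneg_left h (sq_nonneg (g x))
    have h3 : g x ^ 2 * (A / B / |g x| - 1) = A / B * |g x| - g x ^ 2 := by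
      rw [← sq_abs]; field_simp
    push_cast
    nlinarith
  have hlow := cubeMean.mono pt
  rw [cubeMean.sub, cubeMean.add, cubeMean.const_mul, cubeMean.const_mul, cubeMean.const_mul] at hlow
  have e1 : cubeMean (fun x => g x ^ 2 * Real.log (A / B)) = A * Real.log (A / B) := by
    rw [hA, mul_comm, ← cubeMean.const_mul]; simp only [mul_comm]
  rw [e1, ← hA, ← hB, mul_assoc 2 (A / B) B, div_mul_cancel₀ _ hBpos.ne',
    Real.log_div hApos.ne' hBpos.ne'] at hlow
  rw [← hA] at hlsi
  -- A second linearisation, `log u ≤ u - 1` at this `u`, replaces `log (A / B²)` by an expression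
  -- affine in `K`, leaving `K` free.
  have hu : 0 < B ^ 2 / A * Real.exp (K - 1) := by positivity
  have h := Real.log_le_sub_one_of_pos hu
  rw [Real.log_mul (by positivity) (Real.exp_pos _).ne', Real.log_exp,
    Real.log_div (by positivity) hApos.ne', Real.log_pow] at h
  have h2 := mul_le_mul_of_nonneg_left h hApos.le
  have h3 : A * (B ^ 2 / A * Real.exp (K - 1) - 1) = Real.exp (K - 1) * B ^ 2 - A := by
    field_simp
  push_cast at h2
  nlinarith

/-- The Falik–Samorodnitsky inequality on the discrete cube, in linearised form. -/
theorem cube_variance_le_fin (K : ℝ) : ∀ {n : ℕ} (F : (Fin n → Bool) → ℝ),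
    K * (cubeMean (fun x => F x ^ 2) - cubeMean F ^ 2)
      ≤ 4 * ∑ p, cubeMean (fun x => cubeDiff F p x ^ 2)
        + Real.exp (K - 1) * ∑ p, cubeMean (fun x => |cubeDiff F p x|) ^ 2
  | 0, F => by simp [cubeMean]
  | n + 1, F => by
    set a : (Fin n → Bool) → ℝ := fun y => F (Fin.cons true y) with ha
    set b : (Fin n → Bool) → ℝ := fun y => F (Fin.cons false y) with hb
    -- Martingale decomposition: the variance is that of the average over the first coordinate plus
    -- the second moment of the derivative in that coordinate.
    have ih := cube_variance_le_fin K fun y => (a y + b y) / 2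
    have hg := cube_sq_le_energy_add (fun y => (a y - b y) / 2) K
    rw [Fin.sum_univ_succ, Fin.sum_univ_succ]
    have e1 : cubeMean (fun x => F x ^ 2)
        = cubeMean (fun y => ((a y + b y) / 2) ^ 2) + cubeMean (fun y => ((a y - b y) / 2) ^ 2) := by
      rw [cubeMean.cons, ← cubeMean.add]
      congr 1; funext y; simp only [ha, hb]; ring
    have e2 : cubeMean F = cubeMean (fun y => (a y + b y) / 2) := cubeMean.cons F
    have e3 : cubeMean (fun x => |cubeDiff F 0 x|) = cubeMean (fun y => |(a y - b y) / 2|) := by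
      rw [cubeMean.cons]
      congr 1; funext y; simp only [cubeDiff_cons_zero, ha, hb]; ring
    -- The energy splits exactly between average and difference by the parallelogram identity, so
    -- the energies spent on the two pieces are not double counted.
    have e4 : ∀ p : Fin n, cubeMean (fun x => cubeDiff F p.succ x ^ 2)
        = cubeMean (fun y => cubeDiff (fun y => (a y + b y) / 2) p y ^ 2)
          + cubeMean (fun y => cubeDiff (fun y => (a y - b y) / 2) p y ^ 2) := by
      intro p
      rw [cubeMean.cons, ← cubeMean.add]
      congr 1; funext y; simp only [cubeDiff_cons_succ]; simp only [ha, hb, cubeDiff]; ring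
    have e5 : ∀ p : Fin n, cubeMean (fun y => |cubeDiff (fun y => (a y + b y) / 2) p y|) ^ 2
        ≤ cubeMean (fun x => |cubeDiff F p.succ x|) ^ 2 := by
      intro p
      refine pow_le_pow_left₀ (cubeMean.nonneg fun y => abs_nonneg _) ?_ 2
      rw [cubeMean.cons (fun x => |cubeDiff F p.succ x|)]
      refine cubeMean.mono fun y => ?_
      simp only [cubeDiff_cons_succ]
      have e : cubeDiff (fun y => (a y + b y) / 2) p y
          = (cubeDiff a p y + cubeDiff b p y) / 2 := by
        simp only [cubeDiff]; ring
      rw [e, abs_div, abs_two]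
      gcongr
      exact abs_add_le _ _
    have hsum := Finset.sum_le_sum fun p (_ : p ∈ Finset.univ) => e5 p
    have hsum' := mul_le_mul_of_nonneg_left hsum (Real.exp_pos (K - 1)).le
    have h0 : 0 ≤ cubeMean (fun x => cubeDiff F 0 x ^ 2) := cubeMean.nonneg fun x => sq_nonneg _
    simp only [e4, Finset.sum_add_distrib]
    rw [e1, e2, e3]
    linarith

theorem cube_variance_le {α : Type*} [Fintype α] [DecidableEq α] (K : ℝ) (F : (α → Bool) → ℝ) :
    K * (cubeMean (fun x => F x ^ 2) - cubeMean F ^ 2)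
      ≤ 4 * ∑ p, cubeMean (fun x => cubeDiff F p x ^ 2)
        + Real.exp (K - 1) * ∑ p, cubeMean (fun x => |cubeDiff F p x|) ^ 2 := by
  have e := (Fintype.equivFin α).symm
  have h := cube_variance_le_fin K fun x : Fin (Fintype.card α) → Bool => F (x ∘ e.symm)
  have hd : ∀ p x, cubeDiff (fun x : Fin (Fintype.card α) → Bool => F (x ∘ e.symm)) p x
      = cubeDiff F (e p) (x ∘ e.symm) := by
    intro p x
    have : ∀ c, Function.update x p c ∘ e.symm = Function.update (x ∘ e.symm) (e p) c := by
      intro c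
      rw [Function.update_comp_equiv, Equiv.symm_symm]
    simp only [cubeDiff, this]
  simp only [hd] at h
  rw [cubeMean.congr_equiv e F, cubeMean.congr_equiv e fun x => F x ^ 2] at h
  have h1 : ∀ p, cubeMean (fun x : Fin (Fintype.card α) → Bool =>
      cubeDiff F (e p) (x ∘ e.symm) ^ 2) = cubeMean (fun x => cubeDiff F (e p) x ^ 2) := fun p =>
    cubeMean.congr_equiv e fun x => cubeDiff F (e p) x ^ 2
  have h2 : ∀ p, cubeMean (fun x : Fin (Fintype.card α) → Bool =>
      |cubeDiff F (e p) (x ∘ e.symm)|) = cubeMean (fun x => |cubeDiff F (e p) x|) := fun p =>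
    cubeMean.congr_equiv e fun x => |cubeDiff F (e p) x|
  simp only [h1, h2] at h
  rwa [e.sum_comp fun p => cubeMean (fun x => cubeDiff F p x ^ 2),
    e.sum_comp fun p => cubeMean (fun x => |cubeDiff F p x|) ^ 2] at h

end Cube

/-! ### From signs to Gaussian vectors: the central limit theorem. -/

section CentralLimit

open Filter Topology

/-- The sign `±1` encoded by a Boolean. -/
noncomputable def boolSign (b : Bool) : ℝ := if b then 1 else -1

/-- The vector of normalised sums of independent signs. -/
noncomputable def signSum {α : Type*} [Fintype α] (n : ℕ) (ε : α × Fin n → Bool) :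
    EuclideanSpace ℝ α :=
  WithLp.toLp 2 fun p => (√n)⁻¹ * ∑ l, boolSign (ε (p, l))

/-- The uniform probability measure on a finite nonempty type. -/
noncomputable def unifMeasure (β : Type*) [Fintype β] [Nonempty β] [MeasurableSpace β] :
    Measure β :=
  (PMF.uniformOfFintype β).toMeasure

instance (β : Type*) [Fintype β] [Nonempty β] [MeasurableSpace β] :
    IsProbabilityMeasure (unifMeasure β) := by
  unfold unifMeasure; infer_instance

lemma integral_unifMeasure {β E : Type*} [Fintype β] [Nonempty β] [MeasurableSpace β]
    [MeasurableSingletonClass β] [NormedAddCommGroup E] [NormedSpace ℝ E] [CompleteSpace E]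
    (f : β → E) : ∫ b, f b ∂unifMeasure β = (Fintype.card β : ℝ)⁻¹ • ∑ b, f b := by
  unfold unifMeasure
  rw [PMF.integral_eq_sum, Finset.smul_sum]
  simp

lemma integral_unifMeasure_cube {α : Type*} [Fintype α] [DecidableEq α] (F : (α → Bool) → ℝ) :
    ∫ x, F x ∂unifMeasure (α → Bool) = cubeMean F := by
  rw [integral_unifMeasure, cubeMean]
  simp [div_eq_inv_mul]

lemma charFun_boolSign (t : ℝ) :
    charFun ((unifMeasure Bool).map boolSign) t
      = (Complex.exp (t * Complex.I) + Complex.exp (-t * Complex.I)) / 2 := by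
  rw [charFun_apply_real, integral_map (by fun_prop) (by fun_prop), integral_unifMeasure]
  simp [boolSign, div_eq_inv_mul, mul_add]

lemma tendsto_charFun_boolSign_pow (t : ℝ) :
    Tendsto (fun n : ℕ => (charFun ((unifMeasure Bool).map boolSign) ((√n)⁻¹ * t)) ^ n) atTop
      (𝓝 (Complex.exp (-t ^ 2 / 2))) := by
  refine tendsto_charFun_inv_sqrt_mul_pow (by fun_prop) ?_ ?_ t
  · rw [integral_unifMeasure]; simp [boolSign]
  · rw [integral_unifMeasure]; simp [boolSign]

variable {α : Type*} [Fintype α] [DecidableEq α]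

lemma charFun_signSum (n : ℕ) (t : EuclideanSpace ℝ α) :
    charFun ((unifMeasure (α × Fin n → Bool)).map (signSum n)) t
      = ∏ p, charFun ((unifMeasure Bool).map boolSign) ((√n)⁻¹ * t p) ^ n := by
  rw [charFun_apply, integral_map (by fun_prop) (by fun_prop), integral_unifMeasure]
  have e1 : ∀ ε : α × Fin n → Bool,
      Complex.exp ((inner ℝ (signSum n ε) t : ℝ) * Complex.I)
        = ∏ pl : α × Fin n,
          Complex.exp ((((√n)⁻¹ * t pl.1 * boolSign (ε pl) : ℝ) : ℂ) * Complex.I) := by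
    intro ε
    rw [← Complex.exp_sum, ← Finset.sum_mul, ← Complex.ofReal_sum, Fintype.sum_prod_type]
    congr 3
    rw [PiLp.inner_apply]
    refine Finset.sum_congr rfl fun p _ => ?_
    simp only [signSum, RCLike.inner_apply, conj_trivial]
    rw [Finset.mul_sum, Finset.mul_sum]
    exact Finset.sum_congr rfl fun l _ => by ring
  simp only [e1]
  rw [← Fintype.piFinset_univ, ← Finset.prod_univ_sum (fun _ => (Finset.univ : Finset Bool))
    fun (pl : α × Fin n) b =>
      Complex.exp ((((√n)⁻¹ * t pl.1 * boolSign b : ℝ) : ℂ) * Complex.I)]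
  simp only [charFun_boolSign, Fintype.sum_bool, Finset.prod_div_distrib, div_pow,
    Fintype.prod_prod_type, Finset.prod_const, Finset.card_univ, Fintype.card_fin]
  simp [boolSign, div_eq_inv_mul]
  left
  rw [← pow_mul, mul_comm n]

/-- The central limit theorem for vectors of independent sums of signs. -/
theorem tendsto_cubeMean_signSum {f : EuclideanSpace ℝ α → ℝ} (hf : Continuous f) {R : ℝ}
    (hR : ∀ x, |f x| ≤ R) :
    Tendsto (fun n => cubeMean fun ε : α × Fin n → Bool => f (signSum n ε)) atTop
      (𝓝 (∫ x, f x ∂stdGaussian (EuclideanSpace ℝ α))) := by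
  have hm : ∀ n, AEMeasurable (signSum n) (unifMeasure (α × Fin n → Bool)) := fun n => by fun_prop
  let μ : ℕ → ProbabilityMeasure (EuclideanSpace ℝ α) := fun n =>
    ⟨(unifMeasure (α × Fin n → Bool)).map (signSum n), Measure.isProbabilityMeasure_map (hm n)⟩
  let μ₀ : ProbabilityMeasure (EuclideanSpace ℝ α) := ⟨stdGaussian _, inferInstance⟩
  have hlim : Tendsto μ atTop (𝓝 μ₀) := by
    refine ProbabilityMeasure.tendsto_iff_tendsto_charFun.2 fun t => ?_
    simp only [μ, μ₀, ProbabilityMeasure.coe_mk, charFun_signSum, charFun_stdGaussian]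
    have : Complex.exp (-(‖t‖ : ℂ) ^ 2 / 2) = ∏ p, Complex.exp (-(t p : ℂ) ^ 2 / 2) := by
      rw [← Complex.exp_sum, ← Complex.ofReal_pow, EuclideanSpace.real_norm_sq_eq]
      simp [Finset.sum_div, neg_div]
    rw [this]
    exact tendsto_finsetProd _ fun p _ => tendsto_charFun_boolSign_pow (t p)
  have h := ProbabilityMeasure.tendsto_iff_forall_integral_tendsto.1 hlim
    (BoundedContinuousFunction.ofNormedAddCommGroup f hf R hR)
  refine h.congr fun n => ?_
  simp only [μ, ProbabilityMeasure.coe_mk, BoundedContinuousFunction.coe_ofNormedAddCommGroup]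
  rw [integral_map (hm n) hf.aestronglyMeasurable, integral_unifMeasure_cube]

end CentralLimit

/-! ### The variance inequality for smooth functions on Gaussian space. -/

section SmoothVariance

open Filter Topology

variable {α : Type*} [Fintype α] [DecidableEq α]

lemma abs_sub_sub_le_of_lipschitz_fderiv {E : Type*} [NormedAddCommGroup E] [NormedSpace ℝ E]
    {φ : E → ℝ} {φ' : E → E →L[ℝ] ℝ} {L : ℝ} (hφ : ∀ x, HasFDerivAt φ (φ' x) x)
    (hL : ∀ x y, ‖φ' x - φ' y‖ ≤ L * ‖x - y‖) (hL0 : 0 ≤ L) (x h : E) :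
    |φ (x + h) - φ x - φ' x h| ≤ L * ‖h‖ ^ 2 := by
  have := (convex_closedBall x ‖h‖).norm_image_sub_le_of_norm_hasFDerivWithin_le'
    (f := φ) (f' := φ') (φ := φ' x) (C := L * ‖h‖) (x := x) (y := x + h)
    (fun z _ => (hφ z).hasFDerivWithinAt)
    (fun z hz => (hL z x).trans (by
      rw [mem_closedBall_iff_norm] at hz
      gcongr)) (by simp) (by simp)
  simpa [pow_two, mul_assoc] using this

lemma signSum_update (n : ℕ) (ε : α × Fin n → Bool) (p : α) (l : Fin n) (b : Bool) :
    signSum n (Function.update ε (p, l) b)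
      = signSum n ε + ((√n)⁻¹ * (boolSign b - boolSign (ε (p, l)))) • EuclideanSpace.single p 1 := by
  ext p'
  by_cases hp : p' = p
  · subst hp
    have h : ∀ l', boolSign (Function.update ε (p', l) b (p', l'))
        = boolSign (ε (p', l')) + if l' = l then boolSign b - boolSign (ε (p', l)) else 0 := by
      intro l'
      by_cases hl : l' = l
      · subst hl; simp
      · simp [hl]
    simp [signSum, h, Finset.sum_add_distrib, mul_add]
  · simp [signSum, hp]

/-- Flipping one sign moves the normalised sum by `2 / √n` along a coordinate axis. Taylor's
remainder is at most `L (2 / √n)²`, and the factor `1/2` in `cubeDiff` halves both terms. -/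
lemma abs_cubeDiff_signSum_le {φ : EuclideanSpace ℝ α → ℝ}
    {φ' : EuclideanSpace ℝ α → EuclideanSpace ℝ α →L[ℝ] ℝ} {L : ℝ}
    (hφ : ∀ x, HasFDerivAt φ (φ' x) x)
    (hL : ∀ x y, ‖φ' x - φ' y‖ ≤ L * ‖x - y‖) (hL0 : 0 ≤ L) (n : ℕ)
    (ε : α × Fin n → Bool) (p : α) (l : Fin n) :
    |cubeDiff (fun ε => φ (signSum n ε)) (p, l) ε|
      ≤ (√n)⁻¹ * (|φ' (signSum n ε) (EuclideanSpace.single p 1)| + 2 * L * (√n)⁻¹) := by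
  set x := signSum n ε with hx
  have hr : 0 ≤ (√n)⁻¹ := by positivity
  have key : ∀ s : ℝ, |s| = 2 → |φ (x + ((√n)⁻¹ * s) • EuclideanSpace.single p 1) - φ x|
      ≤ 2 * ((√n)⁻¹ * (|φ' x (EuclideanSpace.single p 1)| + 2 * L * (√n)⁻¹)) := by
    intro s hs
    have h := abs_sub_sub_le_of_lipschitz_fderiv hφ hL hL0 x
      (((√n)⁻¹ * s) • EuclideanSpace.single p 1)
    rw [norm_smul, map_smul, smul_eq_mul] at h
    have hn : ‖(√n)⁻¹ * s‖ = (√n)⁻¹ * 2 := by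
      rw [Real.norm_eq_abs, abs_mul, hs, abs_of_nonneg hr]
    rw [hn] at h
    simp only [PiLp.norm_single, norm_one, mul_one] at h
    have h2 : |(√n)⁻¹ * s * φ' x (EuclideanSpace.single p 1)|
        = (√n)⁻¹ * 2 * |φ' x (EuclideanSpace.single p 1)| := by
      rw [abs_mul, abs_mul, hs, abs_of_nonneg hr]
    have h3 := abs_sub_abs_le_abs_sub
      (φ (x + ((√n)⁻¹ * s) • EuclideanSpace.single p 1) - φ x)
      ((√n)⁻¹ * s * φ' x (EuclideanSpace.single p 1))
    rw [h2] at h3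
    nlinarith
  simp only [cubeDiff]
  rw [signSum_update, signSum_update, abs_div, abs_two, div_le_iff₀ two_pos, mul_comm _ (2 : ℝ)]
  cases hε : ε (p, l)
  · have := key 2 (by norm_num)
    simpa [boolSign, ← hx, show (1 : ℝ) + 1 = 2 by norm_num] using this
  · have := key (-2) (by norm_num)
    rw [abs_sub_comm] at this
    simpa [boolSign, ← hx, show (-1 : ℝ) - 1 = -2 by norm_num] using this

lemma sq_abs_add_le {a b : ℝ} (ha : a ^ 2 ≤ 1) (hb : 0 ≤ b) :
    (|a| + b) ^ 2 ≤ a ^ 2 + (2 * b + b ^ 2) := by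
  have : |a| ≤ 1 := by rwa [← sq_le_one_iff_abs_le_one]
  rw [← sq_abs a]
  nlinarith

lemma sum_cubeMean_sq_cubeDiff_le {φ : EuclideanSpace ℝ α → ℝ}
    {φ' : EuclideanSpace ℝ α → EuclideanSpace ℝ α →L[ℝ] ℝ} {L : ℝ}
    (hφ : ∀ x, HasFDerivAt φ (φ' x) x)
    (hL : ∀ x y, ‖φ' x - φ' y‖ ≤ L * ‖x - y‖) (hL0 : 0 ≤ L)
    (h1 : ∀ x, ∑ p, φ' x (EuclideanSpace.single p 1) ^ 2 ≤ 1) {n : ℕ} (hn : n ≠ 0) :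
    ∑ pl : α × Fin n, cubeMean (fun ε => cubeDiff (fun ε => φ (signSum n ε)) pl ε ^ 2)
      ≤ 1 + Fintype.card α * (2 * (2 * L * (√n)⁻¹) + (2 * L * (√n)⁻¹) ^ 2) := by
  set b := 2 * L * (√n)⁻¹ with hb
  have hb0 : 0 ≤ b := by positivity
  have hn' : (n : ℝ) ≠ 0 := by exact_mod_cast hn
  rw [← cubeMean.sum]
  refine (cubeMean.mono (G := fun _ => 1 + Fintype.card α * (2 * b + b ^ 2)) fun ε => ?_).trans
    (cubeMean.const _).le
  set x := signSum n ε
  have hd : ∀ p, φ' x (EuclideanSpace.single p 1) ^ 2 ≤ 1 := fun p =>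
    (Finset.single_le_sum (f := fun p => φ' x (EuclideanSpace.single p 1) ^ 2)
      (fun _ _ => sq_nonneg _) (Finset.mem_univ p)).trans (h1 x)
  -- Each Gaussian coordinate is shared by `n` signs, each carrying a fraction `1 / n` of the
  -- squared derivative, so the sum over signs reproduces the squared gradient up to an error
  -- vanishing with `n`.
  calc ∑ pl : α × Fin n, cubeDiff (fun ε => φ (signSum n ε)) pl ε ^ 2
      ≤ ∑ pl : α × Fin n, (n : ℝ)⁻¹ *
          (φ' x (EuclideanSpace.single pl.1 1) ^ 2 + (2 * b + b ^ 2)) := by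
        refine Finset.sum_le_sum fun pl _ => ?_
        have h := abs_cubeDiff_signSum_le hφ hL hL0 n ε pl.1 pl.2
        rw [← hb] at h
        rw [← sq_abs]
        refine (pow_le_pow_left₀ (abs_nonneg _) h 2).trans ?_
        rw [mul_pow, inv_pow, Real.sq_sqrt (Nat.cast_nonneg n)]
        gcongr
        exact sq_abs_add_le (hd _) hb0
    _ = ∑ p, (φ' x (EuclideanSpace.single p 1) ^ 2 + (2 * b + b ^ 2)) := by
        rw [Fintype.sum_prod_type]
        refine Finset.sum_congr rfl fun p _ => ?_
        simp only [Finset.sum_const, Finset.card_univ, Fintype.card_fin, nsmul_eq_mul]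
        rw [← mul_assoc, mul_inv_cancel₀ hn', one_mul]
    _ ≤ 1 + Fintype.card α * (2 * b + b ^ 2) := by
        rw [Finset.sum_add_distrib]
        simp only [Finset.sum_const, Finset.card_univ, nsmul_eq_mul]
        linarith [h1 x]

lemma sum_sq_cubeMean_cubeDiff_le {φ : EuclideanSpace ℝ α → ℝ}
    {φ' : EuclideanSpace ℝ α → EuclideanSpace ℝ α →L[ℝ] ℝ} {L : ℝ}
    (hφ : ∀ x, HasFDerivAt φ (φ' x) x)
    (hL : ∀ x y, ‖φ' x - φ' y‖ ≤ L * ‖x - y‖) (hL0 : 0 ≤ L)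
    (h1 : ∀ x, ∑ p, φ' x (EuclideanSpace.single p 1) ^ 2 ≤ 1) {n : ℕ} (hn : n ≠ 0) :
    ∑ pl : α × Fin n, cubeMean (fun ε => |cubeDiff (fun ε => φ (signSum n ε)) pl ε|) ^ 2
      ≤ ∑ p, cubeMean (fun ε : α × Fin n → Bool =>
            |φ' (signSum n ε) (EuclideanSpace.single p 1)|) ^ 2
        + Fintype.card α * (2 * (2 * L * (√n)⁻¹) + (2 * L * (√n)⁻¹) ^ 2) := by
  set b := 2 * L * (√n)⁻¹ with hb
  have hb0 : 0 ≤ b := by positivity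
  have hn' : (n : ℝ) ≠ 0 := by exact_mod_cast hn
  set m : α → ℝ := fun p => cubeMean fun ε : α × Fin n → Bool =>
    |φ' (signSum n ε) (EuclideanSpace.single p 1)| with hm
  have hm0 : ∀ p, 0 ≤ m p := fun p => cubeMean.nonneg fun _ => abs_nonneg _
  have hm1 : ∀ p, m p ^ 2 ≤ 1 := by
    intro p
    refine (cubeMean.sq_le _).trans ((cubeMean.mono (G := fun _ => 1) fun ε => ?_).trans
      (cubeMean.const _).le)
    rw [sq_abs]
    exact (Finset.single_le_sum
      (f := fun p => φ' (signSum n ε) (EuclideanSpace.single p 1) ^ 2)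
      (fun _ _ => sq_nonneg _) (Finset.mem_univ p)).trans (h1 _)
  calc ∑ pl : α × Fin n, cubeMean (fun ε => |cubeDiff (fun ε => φ (signSum n ε)) pl ε|) ^ 2
      ≤ ∑ pl : α × Fin n, (n : ℝ)⁻¹ * (m pl.1 ^ 2 + (2 * b + b ^ 2)) := by
        refine Finset.sum_le_sum fun pl _ => ?_
        have h : cubeMean (fun ε => |cubeDiff (fun ε => φ (signSum n ε)) pl ε|)
            ≤ (√n)⁻¹ * (m pl.1 + b) := by
          refine (cubeMean.mono fun ε => abs_cubeDiff_signSum_le hφ hL hL0 n ε pl.1 pl.2).trans ?_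
          rw [cubeMean.const_mul, cubeMean.add, cubeMean.const]
        refine (pow_le_pow_left₀ (cubeMean.nonneg fun _ => abs_nonneg _) h 2).trans ?_
        rw [mul_pow, inv_pow, Real.sq_sqrt (Nat.cast_nonneg n)]
        gcongr
        have := sq_abs_add_le (hm1 pl.1) hb0
        rwa [abs_of_nonneg (hm0 _)] at this
    _ = ∑ p, (m p ^ 2 + (2 * b + b ^ 2)) := by
        rw [Fintype.sum_prod_type]
        refine Finset.sum_congr rfl fun p _ => ?_
        simp only [Finset.sum_const, Finset.card_univ, Fintype.card_fin, nsmul_eq_mul]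
        rw [← mul_assoc, mul_inv_cancel₀ hn', one_mul]
    _ = _ := by
        rw [Finset.sum_add_distrib]
        simp only [Finset.sum_const, Finset.card_univ, nsmul_eq_mul, hm]

/-- The `L¹`–`L²` variance inequality for smooth functions under the standard Gaussian measure. -/
theorem gaussian_variance_le {φ : EuclideanSpace ℝ α → ℝ}
    {φ' : EuclideanSpace ℝ α → EuclideanSpace ℝ α →L[ℝ] ℝ} {L R : ℝ}
    (hφ : ∀ x, HasFDerivAt φ (φ' x) x)
    (hL : ∀ x y, ‖φ' x - φ' y‖ ≤ L * ‖x - y‖) (hL0 : 0 ≤ L) (hR : ∀ x, |φ x| ≤ R)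
    (h1 : ∀ x, ∑ p, φ' x (EuclideanSpace.single p 1) ^ 2 ≤ 1) {δ : ℝ}
    (hδ : ∀ n, ∑ p, cubeMean (fun ε : α × Fin n → Bool =>
      |φ' (signSum n ε) (EuclideanSpace.single p 1)|) ^ 2 ≤ δ) (K : ℝ) :
    K * (∫ x, φ x ^ 2 ∂stdGaussian (EuclideanSpace ℝ α)
        - (∫ x, φ x ∂stdGaussian (EuclideanSpace ℝ α)) ^ 2) ≤ 4 + Real.exp (K - 1) * δ := by
  have hc : Continuous φ := continuous_iff_continuousAt.2 fun x => (hφ x).continuousAt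
  -- Only `φ` and `φ ^ 2` go through the limit. The influences are bounded by `δ` on every cube, so
  -- no convergence of derivatives is needed.
  have t1 := tendsto_cubeMean_signSum hc hR
  have t2 := tendsto_cubeMean_signSum (f := fun x => φ x ^ 2) (R := R ^ 2) (hc.pow 2) fun x => by
    rw [abs_pow]; exact pow_le_pow_left₀ (abs_nonneg _) (hR x) 2
  have tl := (t2.sub (t1.pow 2)).const_mul K
  have hb : Tendsto (fun n : ℕ => 2 * L * (√n)⁻¹) atTop (𝓝 0) := by
    have := (tendsto_inv_atTop_zero.comp <| Real.tendsto_sqrt_atTop.comp <|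
      tendsto_natCast_atTop_atTop (R := ℝ)).const_mul (2 * L)
    simpa using this
  have he : Tendsto (fun n : ℕ =>
      Fintype.card α * (2 * (2 * L * (√n)⁻¹) + (2 * L * (√n)⁻¹) ^ 2)) atTop (𝓝 0) := by
    simpa using ((hb.const_mul 2).add (hb.pow 2)).const_mul (Fintype.card α : ℝ)
  have tr : Tendsto (fun n : ℕ =>
      4 * (1 + Fintype.card α * (2 * (2 * L * (√n)⁻¹) + (2 * L * (√n)⁻¹) ^ 2))
      + Real.exp (K - 1) *
        (δ + Fintype.card α * (2 * (2 * L * (√n)⁻¹) + (2 * L * (√n)⁻¹) ^ 2))) atTop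
      (𝓝 (4 + Real.exp (K - 1) * δ)) := by
    simpa using ((he.const_add 1).const_mul 4).add ((he.const_add δ).const_mul (Real.exp (K - 1)))
  refine le_of_tendsto_of_tendsto tl tr ?_
  filter_upwards [eventually_ne_atTop 0] with n hn
  refine (cube_variance_le K fun ε : α × Fin n → Bool => φ (signSum n ε)).trans ?_
  have a1 := sum_cubeMean_sq_cubeDiff_le hφ hL hL0 h1 hn
  have a2 := sum_sq_cubeMean_cubeDiff_le hφ hL hL0 h1 hn
  have a3 := hδ n
  gcongr
  linarith

end SmoothVariance

/-! ### Radial mollification of Lipschitz functions. -/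

section Mollification

open Filter Topology
open scoped Convolution

variable {E : Type*} [NormedAddCommGroup E] [InnerProductSpace ℝ E] [FiniteDimensional ℝ E]
  [MeasurableSpace E] [BorelSpace E]

/-- There is a radial smooth probability density with arbitrarily small compact support. -/
lemma exists_radial_density {s : ℝ} (hs : 0 < s) :
    ∃ ρ : E → ℝ, ContDiff ℝ 1 ρ ∧ HasCompactSupport ρ ∧ (∀ x, 0 ≤ ρ x) ∧
      ∫ x, ρ x = 1 ∧ (∀ x, s < ‖x‖ → ρ x = 0) ∧ ∀ x y, ‖x‖ = ‖y‖ → ρ x = ρ y := by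
  set ψ : E → ℝ := fun x => Real.smoothTransition (1 - ‖x‖ ^ 2 / s ^ 2) with hψ
  have hψs : ContDiff ℝ 1 ψ :=
    Real.smoothTransition.contDiff.comp
      (contDiff_const.sub ((contDiff_norm_sq ℝ).div_const (s ^ 2)))
  have hψ0 : ∀ x, s < ‖x‖ → ψ x = 0 := by
    intro x hx
    refine Real.smoothTransition.zero_of_nonpos ?_
    rw [sub_nonpos, one_le_div (by positivity)]
    exact pow_le_pow_left₀ hs.le hx.le 2
  have hψc : HasCompactSupport ψ := by
    refine HasCompactSupport.of_support_subset_isCompact (isCompact_closedBall (0 : E) s) ?_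
    intro x hx
    rw [mem_closedBall_zero_iff]
    by_contra h
    exact hx (hψ0 x (not_le.1 h))
  have hψn : ∀ x, 0 ≤ ψ x := fun x => Real.smoothTransition.nonneg _
  have hI : 0 < ∫ x, ψ x :=
    hψs.continuous.integral_pos_of_hasCompactSupport_nonneg_nonzero hψc hψn
      (x := 0) (by simp [hψ, Real.smoothTransition.one_of_one_le le_rfl])
  refine ⟨fun x => ψ x / ∫ y, ψ y, hψs.div_const _, ?_, fun x => div_nonneg (hψn x) hI.le, ?_,
    fun x hx => by simp [hψ0 x hx], fun x y hxy => by simp only [hψ, hxy]⟩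
  · simp only [div_eq_mul_inv]
    exact hψc.mul_right
  · rw [integral_div, div_self hI.ne']

/-- Mollification of a `1`-Lipschitz function by a radial density. -/
theorem exists_mollification {f : E → ℝ} (hf : ∀ x h, f (x + h) ≤ f x + ‖h‖) {s : ℝ}
    (hs : 0 < s) :
    ∃ (φ : E → ℝ) (φ' : E → E →L[ℝ] ℝ) (L : ℝ), 0 ≤ L ∧ (∀ x, HasFDerivAt φ (φ' x) x) ∧
      (∀ x y, ‖φ' x - φ' y‖ ≤ L * ‖x - y‖) ∧ (∀ x, |φ x - f x| ≤ s) ∧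
      (∀ h c, (∀ x, f (x + h) ≤ f x + c) → ∀ x, φ (x + h) ≤ φ x + c) ∧
      (∀ T : E ≃ₗᵢ[ℝ] E, (∀ x, f (T x) = f x) → ∀ x, φ (T x) = φ x) := by
  obtain ⟨ρ, hρs, hρc, hρ0, hρ1, hρz, hρr⟩ := exists_radial_density (E := E) hs
  have habs : ∀ x y, |f x - f y| ≤ ‖x - y‖ := by
    intro x y
    rw [abs_sub_le_iff]
    have h1 := hf y (x - y)
    have h2 := hf x (y - x)
    rw [add_sub_cancel] at h1 h2
    rw [norm_sub_rev] at h2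
    constructor <;> linarith
  have hlip : LipschitzWith 1 f := LipschitzWith.of_dist_le_mul fun x y => by
    simpa [Real.dist_eq, dist_eq_norm] using habs x y
  have hcont := hlip.continuous
  have hli : LocallyIntegrable f (volume : Measure E) := hcont.locallyIntegrable
  have hint : ∀ g : E → ℝ, Continuous g → Integrable (fun t => ρ t * g t) := fun g hg =>
    (hρs.continuous.mul hg).integrable_of_hasCompactSupport hρc.mul_right
  set M := (ContinuousLinearMap.lsmul ℝ ℝ : ℝ →L[ℝ] ℝ →L[ℝ] ℝ) with hM
  have hφ : ∀ x, (ρ ⋆[M, volume] f) x = ∫ t, ρ t * f (x - t) := fun x => rfl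
  have hDc : HasCompactSupport (fderiv ℝ ρ) := hρc.fderiv ℝ
  have hDcont : Continuous (fderiv ℝ ρ) := hρs.continuous_fderiv one_ne_zero
  have hDint : Integrable (fun t => ‖fderiv ℝ ρ t‖) :=
    (hDcont.norm).integrable_of_hasCompactSupport hDc.norm
  have hφf : ∀ x, |(ρ ⋆[M, volume] f) x - f x| ≤ s := by
    intro x
    have e : (ρ ⋆[M, volume] f) x - f x = ∫ t, ρ t * (f (x - t) - f x) := by
      simp only [mul_sub]
      rw [integral_sub (hint _ (by fun_prop)) (hint _ (by fun_prop)), integral_mul_const, hρ1,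
        one_mul, hφ]
    rw [e, ← Real.norm_eq_abs]
    calc ‖∫ t, ρ t * (f (x - t) - f x)‖ ≤ ∫ t, ρ t * s := by
          refine norm_integral_le_of_norm_le (hint _ continuous_const) (.of_forall fun t => ?_)
          rw [norm_mul, Real.norm_eq_abs, Real.norm_eq_abs, abs_of_nonneg (hρ0 t)]
          by_cases ht : s < ‖t‖
          · simp [hρz t ht]
          · refine mul_le_mul_of_nonneg_left ((habs _ _).trans ?_) (hρ0 t)
            simpa using not_lt.1 ht
      _ = s := by rw [integral_mul_const, hρ1, one_mul]
  -- The derivative falls on `ρ`, so its Lipschitz constant is `∫ ‖Dρ‖` because `f` is 1-Lipschitz.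
  -- Slope bounds survive because they are translation invariant, and symmetries survive because `ρ`
  -- is radial.
  refine ⟨ρ ⋆[M, volume] f, (fderiv ℝ ρ) ⋆[M.precompL E, volume] f,
    ∫ t, ‖fderiv ℝ ρ t‖, by positivity,
    fun x => hρc.hasFDerivAt_convolution_left M hρs hli x, ?_, hφf, ?_, ?_⟩
  · intro x y
    have hex := hDc.convolutionExists_left (M.precompL E) hDcont hli
    simp only [convolution]
    rw [← integral_sub (hex x).integrable (hex y).integrable]
    have hb : ∀ t, ‖M.precompL E (fderiv ℝ ρ t) (f (x - t))
        - M.precompL E (fderiv ℝ ρ t) (f (y - t))‖ ≤ ‖x - y‖ * ‖fderiv ℝ ρ t‖ := by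
      intro t
      have e : ∀ b : ℝ, M.precompL E (fderiv ℝ ρ t) b = b • fderiv ℝ ρ t := by
        intro b
        ext v
        simp [ContinuousLinearMap.precompL_apply, hM, mul_comm]
      rw [e, e, ← sub_smul, norm_smul, Real.norm_eq_abs]
      have := habs (x - t) (y - t)
      rw [sub_sub_sub_cancel_right] at this
      gcongr
    refine (norm_integral_le_of_norm_le (hDint.const_mul _) (.of_forall hb)).trans_eq ?_
    rw [integral_const_mul, mul_comm]
  · intro h c hc x
    rw [hφ, hφ]
    have e : ∫ t, ρ t * (f (x - t) + c) = (∫ t, ρ t * f (x - t)) + c := by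
      simp only [mul_add]
      rw [integral_add (hint _ (by fun_prop)) (hint _ (by fun_prop)), integral_mul_const, hρ1,
        one_mul]
    rw [← e]
    refine integral_mono (hint _ (by fun_prop)) (hint _ (by fun_prop)) fun t => ?_
    refine mul_le_mul_of_nonneg_left ?_ (hρ0 t)
    rw [add_sub_right_comm]
    exact hc _
  · intro T hT x
    rw [hφ, hφ, ← T.measurePreserving.integral_comp T.toHomeomorph.measurableEmbedding]
    refine integral_congr_ae (.of_forall fun t => ?_)
    simp only
    rw [← map_sub, hT, hρr (T t) t (T.norm_map t)]

end Mollification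

/-! ### Influence bounds from block slopes and row exchangeability. -/

section BlockLipschitz

open Filter Topology

variable {ι κ β : Type*} [Fintype ι] [Fintype κ] [DecidableEq ι]

/-- The linear isometry exchanging two rows of a matrix. -/
noncomputable def rowSwap (κ : Type*) [Fintype κ] (i i' : ι) :
    EuclideanSpace ℝ (ι × κ) ≃ₗᵢ[ℝ] EuclideanSpace ℝ (ι × κ) :=
  LinearIsometryEquiv.piLpCongrLeft 2 ℝ ℝ ((Equiv.swap i i').prodCongr (Equiv.refl κ))

lemma rowSwap_apply (i i' : ι) (x : EuclideanSpace ℝ (ι × κ)) (p : ι × κ) :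
    rowSwap κ i i' x p = x (Equiv.swap i i' p.1, p.2) := by
  simp only [rowSwap, LinearIsometryEquiv.piLpCongrLeft_apply, Equiv.piCongrLeft'_apply]
  rfl

variable [DecidableEq κ]

lemma rowSwap_single (i i' : ι) (a : ι) (j : κ) :
    rowSwap κ i i' (EuclideanSpace.single (a, j) 1)
      = EuclideanSpace.single (Equiv.swap i i' a, j) 1 := by
  simp [rowSwap]

/-- A function of matrices which is `1`-Lipschitz for the Frobenius norm, has slope at most `c b`
in the directions supported on the rows of block `b` and with rows of norm at most one, and is
invariant under exchanging rows of the same block. -/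
structure BlockLipschitz (bl : ι → β) (c : β → ℝ) (f : EuclideanSpace ℝ (ι × κ) → ℝ) :
    Prop where
  le_add_norm : ∀ x h, f (x + h) ≤ f x + ‖h‖
  le_add_block : ∀ b h, (∀ i, bl i ≠ b → ∀ j, h (i, j) = 0) → (∀ i, ∑ j, h (i, j) ^ 2 ≤ 1) →
    ∀ t : ℝ, 0 ≤ t → ∀ x, f (x + t • h) ≤ f x + t * c b
  rowSwap_eq : ∀ i i', bl i = bl i' → ∀ x, f (rowSwap κ i i' x) = f x

lemma fderiv_apply_le_of_forall_le {E : Type*} [NormedAddCommGroup E] [NormedSpace ℝ E]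
    {φ : E → ℝ} {φ' : E →L[ℝ] ℝ} {x h : E} {c : ℝ} (hφ : HasFDerivAt φ φ' x)
    (hc : ∀ t : ℝ, 0 ≤ t → φ (x + t • h) ≤ φ x + t * c) : φ' h ≤ c := by
  have ht : Tendsto (fun n : ℕ => ‖(n : ℝ)‖) atTop atTop := by
    simpa using tendsto_natCast_atTop_atTop (R := ℝ)
  refine le_of_tendsto (hφ.lim h ht) ?_
  filter_upwards [eventually_gt_atTop 0] with n hn
  have hn' : (0 : ℝ) < n := by exact_mod_cast hn
  have := hc (n : ℝ)⁻¹ (by positivity)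
  rw [smul_eq_mul]
  calc (n : ℝ) * (φ (x + (n : ℝ)⁻¹ • h) - φ x) ≤ n * ((n : ℝ)⁻¹ * c) := by gcongr; linarith
    _ = c := by field_simp

lemma clm_apply_eq_sum {α : Type*} [Fintype α] [DecidableEq α]
    (A : EuclideanSpace ℝ α →L[ℝ] ℝ) (h : EuclideanSpace ℝ α) :
    A h = ∑ p, h p * A (EuclideanSpace.single p 1) := by
  conv_lhs => rw [← (EuclideanSpace.basisFun α ℝ).sum_repr h]
  simp

variable {bl : ι → β} {c : β → ℝ} {φ : EuclideanSpace ℝ (ι × κ) → ℝ}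
  {φ' : EuclideanSpace ℝ (ι × κ) → EuclideanSpace ℝ (ι × κ) →L[ℝ] ℝ}

namespace BlockLipschitz

lemma sum_sq_fderiv_le (H : BlockLipschitz bl c φ) (hφ : ∀ x, HasFDerivAt φ (φ' x) x)
    (x : EuclideanSpace ℝ (ι × κ)) :
    ∑ p, φ' x (EuclideanSpace.single p 1) ^ 2 ≤ 1 := by
  -- Testing the slope bound in the direction of the gradient itself gives `‖g‖² ≤ ‖g‖`.
  set g : EuclideanSpace ℝ (ι × κ) :=
    WithLp.toLp 2 fun p => φ' x (EuclideanSpace.single p 1) with hg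
  have h1 : φ' x g ≤ ‖g‖ := fderiv_apply_le_of_forall_le (hφ x) fun t ht => by
    have := H.le_add_norm x (t • g)
    rwa [norm_smul, Real.norm_eq_abs, abs_of_nonneg ht] at this
  have h2 : φ' x g = ‖g‖ ^ 2 := by
    rw [clm_apply_eq_sum, EuclideanSpace.real_norm_sq_eq]
    exact Finset.sum_congr rfl fun p _ => by simp [hg, pow_two]
  have h3 : ‖g‖ ^ 2 = ∑ p, φ' x (EuclideanSpace.single p 1) ^ 2 := by
    rw [EuclideanSpace.real_norm_sq_eq]
  rw [← h3]
  have : ‖g‖ ≤ 1 := by nlinarith [norm_nonneg g]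
  nlinarith [norm_nonneg g]

lemma sum_block_norm_fderiv_le [DecidableEq β] (H : BlockLipschitz bl c φ)
    (hφ : ∀ x, HasFDerivAt φ (φ' x) x) (x : EuclideanSpace ℝ (ι × κ)) (b : β) :
    ∑ i with bl i = b, √(∑ j, φ' x (EuclideanSpace.single (i, j) 1) ^ 2) ≤ c b := by
  set r : ι → ℝ := fun i => √(∑ j, φ' x (EuclideanSpace.single (i, j) 1) ^ 2) with hr
  have hr2 : ∀ i, r i ^ 2 = ∑ j, φ' x (EuclideanSpace.single (i, j) 1) ^ 2 := fun i =>
    Real.sq_sqrt (Finset.sum_nonneg fun j _ => sq_nonneg _)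
  -- The dual direction: each gradient row in the block is normalised, so the derivative along `h`
  -- is the sum of row norms. A zero row stays zero since division by zero is zero.
  set h : EuclideanSpace ℝ (ι × κ) := WithLp.toLp 2 fun p =>
    if bl p.1 = b then φ' x (EuclideanSpace.single p 1) / r p.1 else 0 with hh
  have h1 : φ' x h ≤ c b := by
    refine fderiv_apply_le_of_forall_le (hφ x) fun t ht => H.le_add_block b h ?_ ?_ t ht x
    · intro i hi j
      simp [hh, hi]
    · intro i
      by_cases hi : bl i = b
      · simp only [hh, hi, if_true, div_pow]
        rw [← Finset.sum_div, ← hr2]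
        exact div_self_le_one _
      · simp [hh, hi]
  refine le_trans (le_of_eq ?_) h1
  rw [clm_apply_eq_sum, Fintype.sum_prod_type, Finset.sum_filter]
  refine Finset.sum_congr rfl fun i _ => ?_
  by_cases hi : bl i = b
  · simp only [hh, hi, if_true]
    change r i = _
    by_cases h0 : r i = 0
    · simp only [h0, div_zero, zero_mul, Finset.sum_const_zero]
    · have : ∀ j, φ' x (EuclideanSpace.single (i, j) 1) / r i
          * φ' x (EuclideanSpace.single (i, j) 1)
          = φ' x (EuclideanSpace.single (i, j) 1) ^ 2 / r i := fun j => by ring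
      simp only [this]
      rw [← Finset.sum_div, ← hr2, pow_two, mul_div_assoc, div_self h0, mul_one]
  · simp [hh, hi]

lemma fderiv_rowSwap (H : BlockLipschitz bl c φ) (hφ : ∀ x, HasFDerivAt φ (φ' x) x) {i i' : ι}
    (hi : bl i = bl i') (x : EuclideanSpace ℝ (ι × κ)) (j : κ) :
    φ' (rowSwap κ i i' x) (EuclideanSpace.single (i', j) 1)
      = φ' x (EuclideanSpace.single (i, j) 1) := by
  have h1 : HasFDerivAt (fun x => φ (rowSwap κ i i' x))
      ((φ' (rowSwap κ i i' x)).comp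
        ((rowSwap κ i i').toContinuousLinearEquiv : _ →L[ℝ] _)) x :=
    (hφ _).comp x (rowSwap κ i i').toContinuousLinearEquiv.hasFDerivAt
  have h2 : (fun x => φ (rowSwap κ i i' x)) = φ := funext (H.rowSwap_eq i i' hi)
  rw [h2] at h1
  have h3 := h1.unique (hφ x)
  have h4 := congrArg (fun A => A (EuclideanSpace.single (i, j) 1)) h3
  simp only [ContinuousLinearMap.comp_apply] at h4
  rw [← h4]
  congr 1
  have := rowSwap_single (κ := κ) i i' i j
  rw [Equiv.swap_apply_left] at this
  exact this.symm

/-- Exchanging two rows permutes the underlying signs, which preserves the uniform measure, and the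
derivative is equivariant under the exchange. -/
lemma cubeMean_norm_row_eq (H : BlockLipschitz bl c φ) (hφ : ∀ x, HasFDerivAt φ (φ' x) x)
    {i i' : ι} (hi : bl i = bl i') (n : ℕ) :
    cubeMean (fun ε : (ι × κ) × Fin n → Bool =>
        √(∑ j, φ' (signSum n ε) (EuclideanSpace.single (i', j) 1) ^ 2))
      = cubeMean (fun ε : (ι × κ) × Fin n → Bool =>
        √(∑ j, φ' (signSum n ε) (EuclideanSpace.single (i, j) 1) ^ 2)) := by
  set e : (ι × κ) × Fin n ≃ (ι × κ) × Fin n :=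
    ((Equiv.swap i i').prodCongr (Equiv.refl κ)).prodCongr (Equiv.refl (Fin n)) with he
  rw [← cubeMean.congr_equiv e fun ε =>
    √(∑ j, φ' (signSum n ε) (EuclideanSpace.single (i', j) 1) ^ 2)]
  congr 1; funext ε
  have hs : signSum n (ε ∘ e.symm) = rowSwap κ i i' (signSum n ε) := by
    ext p
    rw [rowSwap_apply]
    simp only [signSum, he]
    rfl
  simp only [hs, H.fderiv_rowSwap hφ hi]

lemma sum_sq_cubeMean_le_one (H : BlockLipschitz bl c φ) (hφ : ∀ x, HasFDerivAt φ (φ' x) x)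
    (n : ℕ) :
    ∑ p, cubeMean (fun ε : (ι × κ) × Fin n → Bool =>
      |φ' (signSum n ε) (EuclideanSpace.single p 1)|) ^ 2 ≤ 1 := by
  refine (Finset.sum_le_sum fun p _ => cubeMean.sq_le _).trans ?_
  rw [← cubeMean.sum]
  refine (cubeMean.mono fun ε => ?_).trans (cubeMean.const 1).le
  simp only [sq_abs]
  exact H.sum_sq_fderiv_le hφ _

lemma sum_sq_cubeMean_le [DecidableEq β] (H : BlockLipschitz bl c φ)
    (hφ : ∀ x, HasFDerivAt φ (φ' x) x) (n : ℕ) :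
    ∑ p, cubeMean (fun ε : (ι × κ) × Fin n → Bool =>
      |φ' (signSum n ε) (EuclideanSpace.single p 1)|) ^ 2
      ≤ ∑ i, (c (bl i) / (Finset.univ.filter fun i' => bl i' = bl i).card) ^ 2 := by
  rw [Fintype.sum_prod_type]
  refine Finset.sum_le_sum fun i _ => ?_
  set r : ι → ((ι × κ) × Fin n → Bool) → ℝ := fun i ε =>
    √(∑ j, φ' (signSum n ε) (EuclideanSpace.single (i, j) 1) ^ 2) with hr
  set m : κ → ℝ := fun j => cubeMean (fun ε : (ι × κ) × Fin n → Bool =>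
      |φ' (signSum n ε) (EuclideanSpace.single (i, j) 1)|) with hm
  have hr0 : 0 ≤ cubeMean (r i) := cubeMean.nonneg fun _ => Real.sqrt_nonneg _
  -- Minkowski's inequality by duality: pair the vector of means with itself, apply Cauchy–Schwarz
  -- under the mean, then cancel one factor `√(∑ j, m j ^ 2)`.
  have h1 : ∑ j, m j ^ 2 ≤ √(∑ j, m j ^ 2) * cubeMean (r i) := by
    have e : ∑ j, m j ^ 2 = cubeMean (fun ε : (ι × κ) × Fin n → Bool =>
        ∑ j, m j * |φ' (signSum n ε) (EuclideanSpace.single (i, j) 1)|) := by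
      rw [cubeMean.sum]
      refine Finset.sum_congr rfl fun j _ => ?_
      rw [cubeMean.const_mul, pow_two]
    refine (e.le.trans (cubeMean.mono (G := fun ε => √(∑ j, m j ^ 2) * r i ε) fun ε => ?_)).trans_eq
      (cubeMean.const_mul _ _)
    have := Real.sum_mul_le_sqrt_mul_sqrt Finset.univ m
      fun j => |φ' (signSum n ε) (EuclideanSpace.single (i, j) 1)|
    simpa only [sq_abs] using this
  have h2 : ∑ j, m j ^ 2 ≤ cubeMean (r i) ^ 2 := by
    set S := ∑ j, m j ^ 2
    have hS : 0 ≤ S := Finset.sum_nonneg fun j _ => sq_nonneg _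
    have hq := Real.sq_sqrt hS
    have hq0 := Real.sqrt_nonneg S
    rcases hq0.eq_or_lt with h | h
    · rw [← hq, ← h]; nlinarith
    · have : √S ≤ cubeMean (r i) := by nlinarith
      nlinarith
  refine h2.trans (pow_le_pow_left₀ hr0 ?_ 2)
  have hcard : 0 < ((Finset.univ.filter fun i' => bl i' = bl i).card : ℝ) := by
    exact_mod_cast Finset.card_pos.2 ⟨i, by simp⟩
  rw [le_div_iff₀ hcard]
  -- All rows of a block have the same mean norm, so one row gets at most an equal share of the
  -- block total `c (bl i)`.
  calc cubeMean (r i) * ((Finset.univ.filter fun i' => bl i' = bl i).card : ℝ)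
      = ∑ i' with bl i' = bl i, cubeMean (r i') := by
        rw [mul_comm, ← nsmul_eq_mul, ← Finset.sum_const]
        refine Finset.sum_congr rfl fun i' hi' => ?_
        exact H.cubeMean_norm_row_eq hφ (Finset.mem_filter.1 hi').2 n
    _ = cubeMean (fun ε : (ι × κ) × Fin n → Bool => ∑ i' with bl i' = bl i, r i' ε) := (cubeMean.sum (α := (ι × κ) × Fin n) _ r).symm
    _ ≤ c (bl i) := (cubeMean.mono fun ε => H.sum_block_norm_fderiv_le hφ (signSum n ε) (bl i)).trans
        (cubeMean.const _).le

end BlockLipschitz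

end BlockLipschitz

/-! ### Removing boundedness and smoothness. -/

section GaussianBlock

open Filter Topology

variable {ι κ β : Type*} [Fintype ι] [Fintype κ] [DecidableEq ι]
  {bl : ι → β} {c : β → ℝ} {f : EuclideanSpace ℝ (ι × κ) → ℝ}

namespace BlockLipschitz

lemma min_const (H : BlockLipschitz bl c f) (hc : ∀ b, 0 ≤ c b) (R : ℝ) :
    BlockLipschitz bl c fun x => min (f x) R where
  le_add_norm x h := by
    rw [← min_add_add_right]
    exact min_le_min (H.le_add_norm x h) (le_add_of_nonneg_right (norm_nonneg h))
  le_add_block b h h0 h1 t ht x := by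
    rw [← min_add_add_right]
    exact min_le_min (H.le_add_block b h h0 h1 t ht x)
      (le_add_of_nonneg_right (mul_nonneg ht (hc b)))
  rowSwap_eq i i' hi x := by rw [H.rowSwap_eq i i' hi]

lemma exists_smooth_approx (H : BlockLipschitz bl c f) {s : ℝ} (hs : 0 < s) :
    ∃ (φ : EuclideanSpace ℝ (ι × κ) → ℝ)
      (φ' : EuclideanSpace ℝ (ι × κ) → EuclideanSpace ℝ (ι × κ) →L[ℝ] ℝ) (L : ℝ),
      0 ≤ L ∧ (∀ x, HasFDerivAt φ (φ' x) x) ∧ (∀ x y, ‖φ' x - φ' y‖ ≤ L * ‖x - y‖) ∧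
      (∀ x, |φ x - f x| ≤ s) ∧ BlockLipschitz bl c φ := by
  obtain ⟨φ, φ', L, hL0, hφ, hL, hs, hadd, hsym⟩ := exists_mollification H.le_add_norm hs
  exact ⟨φ, φ', L, hL0, hφ, hL, hs,
    ⟨fun x h => hadd h _ (fun x => H.le_add_norm x h) x,
     fun b h h0 h1 t ht => hadd _ _ (H.le_add_block b h h0 h1 t ht),
     fun i i' hi => hsym _ (H.rowSwap_eq i i' hi)⟩⟩

lemma continuous (H : BlockLipschitz bl c f) : Continuous f := by
  refine (LipschitzWith.of_dist_le_mul (K := 1) fun x y => ?_).continuous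
  have h1 := H.le_add_norm y (x - y)
  have h2 := H.le_add_norm x (y - x)
  rw [add_sub_cancel] at h1 h2
  rw [norm_sub_rev] at h2
  rw [NNReal.coe_one, one_mul, Real.dist_eq, dist_eq_norm, abs_sub_le_iff]
  constructor <;> linarith

lemma memLp_two (H : BlockLipschitz bl c f) (h0 : ∀ x, 0 ≤ f x) :
    MemLp f 2 (stdGaussian (EuclideanSpace ℝ (ι × κ))) := by
  have hg : MemLp (fun x : EuclideanSpace ℝ (ι × κ) => f 0 + ‖x‖) 2 (stdGaussian _) :=
    (memLp_const (f 0)).add (IsGaussian.memLp_id _ 2 (by simp)).norm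
  refine hg.mono H.continuous.aestronglyMeasurable (.of_forall fun x => ?_)
  rw [Real.norm_eq_abs, Real.norm_eq_abs, abs_of_nonneg (h0 x),
    abs_of_nonneg (add_nonneg (h0 0) (norm_nonneg x))]
  simpa using H.le_add_norm 0 x

variable [DecidableEq κ] [DecidableEq β]

lemma gaussian_variance_le_of_hasFDerivAt {φ : EuclideanSpace ℝ (ι × κ) → ℝ}
    (H : BlockLipschitz bl c φ)
    {φ' : EuclideanSpace ℝ (ι × κ) → EuclideanSpace ℝ (ι × κ) →L[ℝ] ℝ} {L R : ℝ}
    (hφ : ∀ x, HasFDerivAt φ (φ' x) x)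
    (hL : ∀ x y, ‖φ' x - φ' y‖ ≤ L * ‖x - y‖) (hL0 : 0 ≤ L) (hR : ∀ x, |φ x| ≤ R) (K : ℝ) :
    K * (∫ x, φ x ^ 2 ∂stdGaussian (EuclideanSpace ℝ (ι × κ))
        - (∫ x, φ x ∂stdGaussian (EuclideanSpace ℝ (ι × κ))) ^ 2)
      ≤ 4 + Real.exp (K - 1) *
        min 1 (∑ i, (c (bl i) / (Finset.univ.filter fun i' => bl i' = bl i).card) ^ 2) :=
  gaussian_variance_le hφ hL hL0 hR (H.sum_sq_fderiv_le hφ)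
    (fun n => le_min (H.sum_sq_cubeMean_le_one hφ n) (H.sum_sq_cubeMean_le hφ n)) K

/-- The variance bound for block-Lipschitz functions under the standard Gaussian measure. -/
theorem variance_le (H : BlockLipschitz bl c f) (hc : ∀ b, 0 ≤ c b) (h0 : ∀ x, 0 ≤ f x) (K : ℝ) :
    K * variance f (stdGaussian (EuclideanSpace ℝ (ι × κ)))
      ≤ 4 + Real.exp (K - 1) *
        min 1 (∑ i, (c (bl i) / (Finset.univ.filter fun i' => bl i' = bl i).card) ^ 2) := by
  have hs : ∀ n : ℕ, (0 : ℝ) < 1 / ((n : ℝ) + 1) := fun n => by positivity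
  -- The `n`-th function mollifies `min f n` to within `1 / (n + 1)`. It is bounded, converges to
  -- `f` pointwise, and is dominated by `f + 1`, which is square-integrable.
  choose φ φ' L hL0 hφ hL hap Hφ using fun n : ℕ =>
    (H.min_const hc n).exists_smooth_approx (hs n)
  have hs1 : ∀ n : ℕ, 1 / ((n : ℝ) + 1) ≤ 1 := fun n => by
    rw [div_le_one (by positivity)]; linarith [(Nat.cast_nonneg n : (0 : ℝ) ≤ n)]
  have hR : ∀ n x, |φ n x| ≤ n + 1 := by
    intro n x
    have h1 := abs_le.1 (hap n x)
    have h2 : 0 ≤ min (f x) n := le_min (h0 x) (Nat.cast_nonneg n)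
    have h3 : min (f x) n ≤ n := min_le_right _ _
    have h4 := hs1 n
    rw [abs_le]; constructor <;> linarith [(Nat.cast_nonneg n : (0 : ℝ) ≤ n)]
  have hbd : ∀ n x, |φ n x| ≤ f x + 1 := by
    intro n x
    have h1 := abs_le.1 (hap n x)
    have h2 : 0 ≤ min (f x) n := le_min (h0 x) (Nat.cast_nonneg n)
    have h3 : min (f x) n ≤ f x := min_le_left _ _
    have h4 := hs1 n
    have h5 := h0 x
    rw [abs_le]; constructor <;> linarith
  have hlim : ∀ x, Tendsto (fun n => φ n x) atTop (𝓝 (f x)) := by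
    intro x
    have h1 : Tendsto (fun n => φ n x - min (f x) n) atTop (𝓝 0) :=
      squeeze_zero_norm (fun n => hap n x) tendsto_one_div_add_atTop_nhds_zero_nat
    have h2 : Tendsto (fun n : ℕ => min (f x) n) atTop (𝓝 (f x)) := by
      refine tendsto_const_nhds.congr' ?_
      filter_upwards [tendsto_natCast_atTop_atTop.eventually_ge_atTop (f x)] with n hn
      rw [min_eq_left hn]
    simpa using h1.add h2
  have hcφ : ∀ n, Continuous (φ n) := fun n => (Hφ n).continuous
  have hmem := H.memLp_two h0
  have hmem1 : MemLp (fun x => f x + 1) 2 (stdGaussian (EuclideanSpace ℝ (ι × κ))) :=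
    hmem.add (memLp_const 1)
  have t1 : Tendsto (fun n => ∫ x, φ n x ∂stdGaussian (EuclideanSpace ℝ (ι × κ))) atTop
      (𝓝 (∫ x, f x ∂stdGaussian _)) :=
    tendsto_integral_of_dominated_convergence (fun x => f x + 1)
      (fun n => (hcφ n).aestronglyMeasurable) (hmem1.integrable one_le_two)
      (fun n => .of_forall fun x => hbd n x) (.of_forall hlim)
  have t2 : Tendsto (fun n => ∫ x, φ n x ^ 2 ∂stdGaussian (EuclideanSpace ℝ (ι × κ))) atTop
      (𝓝 (∫ x, f x ^ 2 ∂stdGaussian _)) :=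
    tendsto_integral_of_dominated_convergence (fun x => (f x + 1) ^ 2)
      (fun n => ((hcφ n).pow 2).aestronglyMeasurable) hmem1.integrable_sq
      (fun n => .of_forall fun x => by
        rw [norm_pow]; exact pow_le_pow_left₀ (norm_nonneg _) (hbd n x) 2)
      (.of_forall fun x => (hlim x).pow 2)
  rw [variance_eq_sub hmem]
  exact le_of_tendsto ((t2.sub (t1.pow 2)).const_mul K) (.of_forall fun n =>
    (Hφ n).gaussian_variance_le_of_hasFDerivAt (hφ n) (hL n) (hL0 n) (hR n) K)

end BlockLipschitz

end GaussianBlock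

/-! ### Comparison of `ℓ^q` norms. -/

section LqNorm

variable {ι : Type*} [Fintype ι]

lemma norm_toLp_le_norm_toLp_two {q : ℝ≥0∞} (hq : 2 ≤ q) (v : ι → ℝ) :
    ‖WithLp.toLp q v‖ ≤ ‖WithLp.toLp 2 v‖ := by
  have hco : ∀ i, |v i| ≤ ‖WithLp.toLp 2 v‖ := fun i => by
    simpa using PiLp.norm_apply_le (WithLp.toLp 2 v) i
  rcases eq_or_ne q ∞ with rfl | hqt
  · rw [PiLp.norm_eq_ciSup]
    exact Real.iSup_le (fun i => by simpa using hco i) (norm_nonneg _)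
  have h2 : 2 ≤ q.toReal := by
    simpa using (ENNReal.toReal_le_toReal (by simp) hqt).2 hq
  have hq0 : 0 < q.toReal := by linarith
  rw [PiLp.norm_eq_sum hq0]
  set S := ‖WithLp.toLp 2 v‖ with hS
  have hS0 : 0 ≤ S := norm_nonneg _
  have hsq : ∑ i, v i ^ 2 = S ^ 2 := (EuclideanSpace.real_norm_sq_eq (WithLp.toLp 2 v)).symm
  have hterm : ∀ i, |v i| ^ q.toReal ≤ S ^ (q.toReal - 2) * v i ^ 2 := by
    intro i
    have e : |v i| ^ q.toReal = |v i| ^ (q.toReal - 2) * v i ^ 2 := by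
      rw [← sq_abs (v i), ← Real.rpow_natCast |v i| 2,
        ← Real.rpow_add_of_nonneg (abs_nonneg _) (by linarith) (by norm_num)]
      congr 1; push_cast; ring
    rw [e]
    exact mul_le_mul_of_nonneg_right
      (Real.rpow_le_rpow (abs_nonneg _) (hco i) (by linarith)) (sq_nonneg _)
  have hsum : ∑ i, |v i| ^ q.toReal ≤ S ^ q.toReal := by
    refine (Finset.sum_le_sum fun i _ => hterm i).trans_eq ?_
    rw [← Finset.mul_sum, hsq, ← Real.rpow_natCast S 2,
      ← Real.rpow_add_of_nonneg hS0 (by linarith) (by norm_num)]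
    congr 1; push_cast; ring
  calc (∑ i, ‖v i‖ ^ q.toReal) ^ (1 / q.toReal) ≤ (S ^ q.toReal) ^ (1 / q.toReal) := by
        refine Real.rpow_le_rpow (Finset.sum_nonneg fun i _ => by positivity) ?_ (by positivity)
        simpa only [Real.norm_eq_abs] using hsum
    _ = S := by rw [one_div, Real.rpow_rpow_inv hS0 hq0.ne']

/-- Supplies the block slope `M_b^(1/q)`. The exponent `(q⁻¹).toReal` is `0` at `q = ∞`, matching
the sup norm. -/
lemma norm_toLp_le_card_rpow {q : ℝ≥0∞} (hq : 2 ≤ q) {s : Finset ι} {v : ι → ℝ} {t : ℝ}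
    (ht : 0 ≤ t) (hv : ∀ i, |v i| ≤ t) (h0 : ∀ i, i ∉ s → v i = 0) :
    ‖WithLp.toLp q v‖ ≤ t * (s.card : ℝ) ^ (q⁻¹).toReal := by
  rcases eq_or_ne q ∞ with rfl | hqt
  · rw [PiLp.norm_eq_ciSup]
    simp only [ENNReal.inv_top, ENNReal.toReal_zero, Real.rpow_zero, mul_one]
    exact Real.iSup_le (fun i => by simpa using hv i) ht
  have h2 : 2 ≤ q.toReal := by
    simpa using (ENNReal.toReal_le_toReal (by simp) hqt).2 hq
  have hq0 : 0 < q.toReal := by linarith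
  rw [PiLp.norm_eq_sum hq0, ENNReal.toReal_inv, one_div]
  have hsum : ∑ i, ‖v i‖ ^ q.toReal ≤ t ^ q.toReal * s.card := by
    calc ∑ i, ‖v i‖ ^ q.toReal = ∑ i ∈ s, ‖v i‖ ^ q.toReal := by
          refine (Finset.sum_subset (Finset.subset_univ s) fun i _ hi => ?_).symm
          rw [h0 i hi, norm_zero, Real.zero_rpow hq0.ne']
      _ ≤ ∑ _i ∈ s, t ^ q.toReal := Finset.sum_le_sum fun i _ =>
          Real.rpow_le_rpow (norm_nonneg _) (hv i) hq0.le
      _ = t ^ q.toReal * s.card := by rw [Finset.sum_const, nsmul_eq_mul, mul_comm]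
  calc (∑ i, ‖v i‖ ^ q.toReal) ^ (q.toReal)⁻¹ ≤ (t ^ q.toReal * s.card) ^ (q.toReal)⁻¹ := by
        gcongr
    _ = t * (s.card : ℝ) ^ (q.toReal)⁻¹ := by
        rw [Real.mul_rpow (by positivity) (by positivity), Real.rpow_rpow_inv ht hq0.ne']

end LqNorm

/-! ### The margin as a block-Lipschitz function of the matrix entries. -/

section Margin

lemma sq_mulVec_le {ι κ : Type*} [Fintype κ] (H : Matrix ι κ ℝ) {σ : EuclideanSpace ℝ κ} (hσ : ‖σ‖ ≤ 1) (i : ι) :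
    (H *ᵥ WithLp.ofLp σ) i ^ 2 ≤ ∑ j, H i j ^ 2 := by
  have h1 := Finset.sum_mul_sq_le_sq_mul_sq Finset.univ (H i) (WithLp.ofLp σ)
  have h2 : ∑ j, σ j ^ 2 ≤ 1 := by
    rw [← EuclideanSpace.real_norm_sq_eq]
    exact pow_le_one₀ (norm_nonneg _) hσ
  have h3 : 0 ≤ ∑ j, H i j ^ 2 := Finset.sum_nonneg fun j _ => sq_nonneg _
  calc (H *ᵥ WithLp.ofLp σ) i ^ 2 ≤ (∑ j, H i j ^ 2) * ∑ j, σ j ^ 2 := h1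
    _ ≤ ∑ j, H i j ^ 2 := mul_le_of_le_one_right h3 h2

variable {ι κ : Type*} [Fintype ι] [Fintype κ] {q : ℝ≥0∞}

lemma lqDist_nonneg (x : ι → ℝ) (E : Set (ι → ℝ)) [Fact (1 ≤ q)] : 0 ≤ lqDist q x E :=
  Real.iInf_nonneg fun _ => norm_nonneg _

lemma lqMargin_nonneg (Q : Set (EuclideanSpace ℝ κ)) (E : Set (ι → ℝ)) (A : Matrix ι κ ℝ)
    [Fact (1 ≤ q)] : 0 ≤ lqMargin q Q E A :=
  Real.iInf_nonneg fun _ => lqDist_nonneg _ _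

lemma lqDist_add_le [Fact (1 ≤ q)] {E : Set (ι → ℝ)} (hE : E.Nonempty) (x v : ι → ℝ) :
    lqDist q (x + v) E ≤ lqDist q x E + ‖WithLp.toLp q v‖ := by
  have := hE.to_subtype
  rw [← sub_le_iff_le_add]
  refine le_ciInf fun y => ?_
  rw [sub_le_iff_le_add]
  refine (ciInf_le ⟨0, ?_⟩ y).trans ?_
  · rintro _ ⟨y, rfl⟩; exact norm_nonneg _
  · rw [add_sub_right_comm, WithLp.toLp_add]
    exact norm_add_le _ _

lemma lqMargin_add_le [Fact (1 ≤ q)] {Q : Set (EuclideanSpace ℝ κ)} (hQ : Q.Nonempty)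
    {E : Set (ι → ℝ)} (hE : E.Nonempty) (A H : Matrix ι κ ℝ) {t : ℝ}
    (hH : ∀ σ ∈ Q, ‖WithLp.toLp q (H *ᵥ WithLp.ofLp σ)‖ ≤ t) :
    lqMargin q Q E (A + H) ≤ lqMargin q Q E A + t := by
  have := hQ.to_subtype
  rw [← sub_le_iff_le_add]
  refine le_ciInf fun σ => ?_
  rw [sub_le_iff_le_add]
  refine (ciInf_le ⟨0, ?_⟩ σ).trans ?_
  · rintro _ ⟨y, rfl⟩; exact lqDist_nonneg _ _
  · rw [Matrix.add_mulVec]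
    refine (lqDist_add_le hE _ _).trans ?_
    have := hH σ σ.2
    gcongr

lemma lqDist_comp_perm [Fact (1 ≤ q)] {E : Set (ι → ℝ)} (π : Equiv.Perm ι)
    (hE : ∀ x, x ∈ E ↔ x ∘ π ∈ E) (x : ι → ℝ) : lqDist q (x ∘ π) E = lqDist q x E := by
  unfold lqDist
  symm
  refine Equiv.iInf_congr ((π.symm.arrowCongr (Equiv.refl ℝ)).subtypeEquiv fun y => hE y)
    fun y => ?_
  have := (LinearIsometryEquiv.piLpCongrLeft q ℝ ℝ π.symm).norm_map
    (WithLp.toLp q (x - (y : ι → ℝ)))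
  rw [← this]
  congr 1

lemma lqMargin_submatrix_perm [Fact (1 ≤ q)] (Q : Set (EuclideanSpace ℝ κ)) {E : Set (ι → ℝ)}
    (π : Equiv.Perm ι) (hE : ∀ x, x ∈ E ↔ x ∘ π ∈ E) (A : Matrix ι κ ℝ) :
    lqMargin q Q E (A.submatrix π id) = lqMargin q Q E A := by
  unfold lqMargin
  congr 1; funext σ
  rw [← lqDist_comp_perm π hE (A *ᵥ _)]
  rfl

/-- Permuting coordinates within a block preserves a product of permutation-symmetric sets. -/
lemma mem_blockProd_comp_swap {k : ℕ} {M : Fin k → ℕ} {E : (i : Fin k) → Set (Fin (M i) → ℝ)}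
    (hE : ∀ i, HasPermSymmetry (E i)) {a a' : Σ i : Fin k, Fin (M i)} (h : a.1 = a'.1)
    (x : (Σ i : Fin k, Fin (M i)) → ℝ) :
    x ∈ blockProd E ↔ x ∘ Equiv.swap a a' ∈ blockProd E := by
  obtain ⟨b, u⟩ := a
  obtain ⟨b', u'⟩ := a'
  obtain rfl : b = b' := h
  refine forall_congr' fun i => ?_
  by_cases hi : i = b
  · subst hi
    rw [hE i (Equiv.swap u u')]
    have : (fun v => x ⟨i, Equiv.swap u u' v⟩)
        = fun v => (x ∘ Equiv.swap (⟨i, u⟩ : Σ i : Fin k, Fin (M i)) ⟨i, u'⟩) ⟨i, v⟩ := by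
      funext v
      rw [Function.comp_apply]
      congr 1
      exact (sigma_mk_injective (β := fun i => Fin (M i)) (i := i)).map_swap u u' v
    rw [this]
  · have : (fun v => x ⟨i, v⟩)
        = fun v => (x ∘ Equiv.swap (⟨b, u⟩ : Σ i : Fin k, Fin (M i)) ⟨b, u'⟩) ⟨i, v⟩ := by
      funext v
      rw [Function.comp_apply, Equiv.swap_apply_of_ne_of_ne]
      · exact fun h => hi (congrArg Sigma.fst h)
      · exact fun h => hi (congrArg Sigma.fst h)
    rw [this]

lemma blockProd_nonempty {k : ℕ} {M : Fin k → ℕ} {E : (i : Fin k) → Set (Fin (M i) → ℝ)}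
    (hE : ∀ i, (E i).Nonempty) : (blockProd E).Nonempty := by
  choose y hy using hE
  exact ⟨fun p => y p.1 p.2, fun i => hy i⟩

/-- The matrix with a given vector of entries. -/
def entriesMatrix (x : EuclideanSpace ℝ (ι × κ)) : Matrix ι κ ℝ := fun i j => x (i, j)

theorem blockLipschitz_lqMargin {k : ℕ} {M : Fin k → ℕ} (hq : 2 ≤ q)
    {Q : Set (EuclideanSpace ℝ κ)} (hQ : Q.Nonempty) (hQ1 : Q ⊆ Metric.closedBall 0 1)
    {E : (i : Fin k) → Set (Fin (M i) → ℝ)} (hE : ∀ i, (E i).Nonempty)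
    (hsym : ∀ i, HasPermSymmetry (E i)) :
    BlockLipschitz (κ := κ) (Sigma.fst : (Σ i : Fin k, Fin (M i)) → Fin k)
      (fun b => (M b : ℝ) ^ (q⁻¹).toReal)
      fun x => lqMargin q Q (blockProd E) (entriesMatrix x) where
  le_add_norm x h := by
    have : Fact (1 ≤ q) := ⟨one_le_two.trans hq⟩
    refine lqMargin_add_le hQ (blockProd_nonempty hE) (entriesMatrix x) (entriesMatrix h)
      fun σ hσ => (norm_toLp_le_norm_toLp_two hq _).trans ?_
    rw [← sq_le_sq₀ (norm_nonneg _) (norm_nonneg _), EuclideanSpace.real_norm_sq_eq,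
      EuclideanSpace.real_norm_sq_eq, Fintype.sum_prod_type]
    exact Finset.sum_le_sum fun i _ =>
      sq_mulVec_le (entriesMatrix h) (by simpa using hQ1 hσ) i
  le_add_block b h h0 h1 t ht x := by
    have : Fact (1 ≤ q) := ⟨one_le_two.trans hq⟩
    refine lqMargin_add_le hQ (blockProd_nonempty hE) (entriesMatrix x) (entriesMatrix (t • h))
      fun σ hσ => ?_
    have hcard : (Finset.univ.filter fun i : Σ i : Fin k, Fin (M i) => i.1 = b).card = M b := by
      rw [← Fintype.card_subtype, Fintype.card_congr (Equiv.sigmaSubtype b), Fintype.card_fin]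
    have e : entriesMatrix (t • h) = t • entriesMatrix h := rfl
    rw [e, Matrix.smul_mulVec, ← hcard]
    refine norm_toLp_le_card_rpow hq ht (fun i => ?_) fun i hi => ?_
    · have := (sq_mulVec_le (entriesMatrix h) (σ := σ) (by simpa using hQ1 hσ) i).trans (h1 i)
      rw [sq_le_one_iff_abs_le_one] at this
      rw [Pi.smul_apply, smul_eq_mul, abs_mul, abs_of_nonneg ht]
      exact mul_le_of_le_one_right ht this
    · have hi' : i.1 ≠ b := fun h => hi (by simp [h])
      rw [Pi.smul_apply]
      have : (entriesMatrix h *ᵥ WithLp.ofLp σ) i = 0 :=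
        Finset.sum_eq_zero fun j _ => by simp [entriesMatrix, h0 i hi' j]
      rw [this, smul_zero]
  rowSwap_eq i i' hi x := by
    have : Fact (1 ≤ q) := ⟨one_le_two.trans hq⟩
    rw [← lqMargin_submatrix_perm Q (Equiv.swap i i') (mem_blockProd_comp_swap hsym hi)
      (entriesMatrix x)]
    congr 1

lemma IsStdGaussianMatrix.hasLaw {Ω : Type*} [MeasurableSpace Ω] {P : Measure Ω}
    [IsProbabilityMeasure P] {A : Ω → Matrix ι κ ℝ} (hA : IsStdGaussianMatrix A P) :
    HasLaw (fun ω => WithLp.toLp 2 fun p : ι × κ => A ω p.1 p.2)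
      (stdGaussian (EuclideanSpace ℝ (ι × κ))) P := by
  have hm : ∀ p : ι × κ, AEMeasurable (fun ω => A ω p.1 p.2) P := fun p => (hA.1 _ _).aemeasurable
  refine ⟨by fun_prop, ?_⟩
  have h1 := (iIndepFun_iff_map_fun_eq_pi_map hm).1 hA.2
  have h2 : P.map (fun ω => WithLp.toLp 2 fun p : ι × κ => A ω p.1 p.2)
      = (P.map fun ω (p : ι × κ) => A ω p.1 p.2).map (WithLp.toLp 2) := by
    rw [AEMeasurable.map_map_of_aemeasurable (by fun_prop) (by fun_prop)]
    rfl
  rw [h2, h1, ← map_pi_eq_stdGaussian]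
  simp only [(hA.1 _ _).map_eq]

end Margin

/-! ### Choice of the parameter and conclusion. -/

/-- The exponential of the logarithmic factor compensates the influences. -/
lemma max_mul_min_sum_le_one {k : ℕ} {M : Fin k → ℕ} {m : ℕ} (hm : IsLeast (Set.range M) m)
    {r : ℝ} (hr : 2 * r ≤ 1) :
    max ((m : ℝ) ^ (1 - 2 * r) / (k : ℝ)) 1 *
      min 1 (∑ i : Σ i : Fin k, Fin (M i), ((M i.1 : ℝ) ^ r / M i.1) ^ 2) ≤ 1 := by
  obtain ⟨⟨i₀, hi₀⟩, hlow⟩ := hm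
  have hk : (0 : ℝ) < k := by exact_mod_cast i₀.pos
  have hk1 : (1 : ℝ) ≤ k := by exact_mod_cast i₀.pos
  rcases le_or_gt ((m : ℝ) ^ (1 - 2 * r) / (k : ℝ)) 1 with hX | hX
  · rw [max_eq_right hX, one_mul]
    exact min_le_left _ _
  rw [max_eq_left hX.le]
  have hm0 : 0 < m := by
    rcases Nat.eq_zero_or_pos m with rfl | h
    -- For `m = 0` the power is `0` or, at exponent zero, `1`; in either case it does not exceed
    -- `k`.
    · exfalso
      rw [Nat.cast_zero, one_lt_div hk] at hX
      have := Real.zero_rpow_le_one (1 - 2 * r)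
      linarith
    · exact h
  have hm0' : (0 : ℝ) < m := by exact_mod_cast hm0
  have hMm : ∀ b, (m : ℝ) ≤ M b := fun b => by exact_mod_cast hlow ⟨b, rfl⟩
  have hsum : ∑ i : Σ i : Fin k, Fin (M i), ((M i.1 : ℝ) ^ r / M i.1) ^ 2
      ≤ k * (m : ℝ) ^ (2 * r - 1) := by
    rw [Fintype.sum_sigma]
    calc ∑ b : Fin k, ∑ _a : Fin (M b), ((M b : ℝ) ^ r / M b) ^ 2
        ≤ ∑ _b : Fin k, (m : ℝ) ^ (2 * r - 1) := by
          refine Finset.sum_le_sum fun b _ => ?_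
          have hMb : (0 : ℝ) < M b := hm0'.trans_le (hMm b)
          rw [Finset.sum_const, Finset.card_univ, Fintype.card_fin, nsmul_eq_mul]
          have e : (M b : ℝ) * ((M b : ℝ) ^ r / M b) ^ 2 = (M b : ℝ) ^ (2 * r - 1) := by
            rw [Real.rpow_sub_one hMb.ne', two_mul, Real.rpow_add hMb]
            field_simp
          rw [e]
          exact Real.rpow_le_rpow_of_nonpos hm0' (hMm b) (by linarith)
      _ = k * (m : ℝ) ^ (2 * r - 1) := by simp
  calc (m : ℝ) ^ (1 - 2 * r) / (k : ℝ) *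
        min 1 (∑ i : Σ i : Fin k, Fin (M i), ((M i.1 : ℝ) ^ r / M i.1) ^ 2)
      ≤ (m : ℝ) ^ (1 - 2 * r) / (k : ℝ) * (k * (m : ℝ) ^ (2 * r - 1)) := by
        gcongr
        exact (min_le_right _ _).trans hsum
    _ = (m : ℝ) ^ (1 - 2 * r) * (m : ℝ) ^ (2 * r - 1) := by field_simp
    _ = 1 := by rw [← Real.rpow_add hm0']; simp

theorem theorem2 :
    ∃ C : ℝ, 0 < C ∧
      ∀ (N k : ℕ) (M : Fin k → ℕ) (m : ℕ), IsLeast (Set.range M) m →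
      ∀ (Q : Set (EuclideanSpace ℝ (Fin N))), Q.Nonempty → Q ⊆ Metric.closedBall 0 1 →
      ∀ (E : (i : Fin k) → Set (Fin (M i) → ℝ)),
        (∀ i, (E i).Nonempty) → (∀ i, HasPermSymmetry (E i)) →
      ∀ (q : ℝ≥0∞), 2 ≤ q →
      ∀ {Ω : Type*} [MeasurableSpace Ω] (P : Measure Ω) [IsProbabilityMeasure P]
        (A : Ω → Matrix (Σ i : Fin k, Fin (M i)) (Fin N) ℝ), IsStdGaussianMatrix A P →
        MemLp (fun ω => lqMargin q Q (blockProd E) (A ω)) 2 P ∧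
        variance (fun ω => lqMargin q Q (blockProd E) (A ω)) P ≤
          C * (1 + 1 / 2 * Real.log (max ((m : ℝ) ^ (1 - 2 / q).toReal / (k : ℝ)) 1))⁻¹ := by
  -- `5 = 4 + 1`: the energy constant plus the bound on the compensated influence term.
  refine ⟨5, by norm_num, ?_⟩
  intro N k M m hm Q hQ hQ1 E hE hsym q hq Ω _ P _ A hA
  have : Fact (1 ≤ q) := ⟨one_le_two.trans hq⟩
  set T : Ω → EuclideanSpace ℝ ((Σ i : Fin k, Fin (M i)) × Fin N) :=
    fun ω => WithLp.toLp 2 fun p => A ω p.1 p.2 with hT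
  have hlaw : HasLaw T (stdGaussian _) P := hA.hasLaw
  set f : EuclideanSpace ℝ ((Σ i : Fin k, Fin (M i)) × Fin N) → ℝ :=
    fun x => lqMargin q Q (blockProd E) (entriesMatrix x) with hf
  have H := blockLipschitz_lqMargin hq hQ hQ1 hE hsym
  have hf0 : ∀ x, 0 ≤ f x := fun x => lqMargin_nonneg Q _ _
  have hfT : (fun ω => lqMargin q Q (blockProd E) (A ω)) = f ∘ T := rfl
  have hmem : MemLp f 2 (P.map T) := hlaw.map_eq ▸ H.memLp_two hf0
  rw [hfT]
  refine ⟨hmem.comp_of_map hlaw.aemeasurable, ?_⟩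
  rw [← variance_map hmem.1.aemeasurable hlaw.aemeasurable, hlaw.map_eq]
  set r := (q⁻¹).toReal with hr
  have hr2 : 2 * q⁻¹ ≤ 1 := by
    rw [← div_eq_mul_inv]
    exact ENNReal.div_le_of_le_mul (by rwa [one_mul])
  have hr1 : 2 * r ≤ 1 := by
    have := ENNReal.toReal_mono ENNReal.one_ne_top hr2
    simpa [hr] using this
  have hexp : (1 - 2 / q).toReal = 1 - 2 * r := by
    rw [div_eq_mul_inv, ENNReal.toReal_sub_of_le hr2 ENNReal.one_ne_top]
    simp [hr]
  rw [hexp]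
  set Y := max ((m : ℝ) ^ (1 - 2 * r) / (k : ℝ)) 1 with hY
  have hY1 : 1 ≤ Y := le_max_right _ _
  have hlog : 0 ≤ Real.log Y := Real.log_nonneg hY1
  -- With `K = 1 + log Y` the factor `exp (K - 1)` is exactly `Y`.
  have hv := H.variance_le (fun b => by positivity) hf0 (1 + Real.log Y)
  have hcard : ∀ b, (Finset.univ.filter fun i : Σ i : Fin k, Fin (M i) => i.1 = b).card = M b := by
    intro b
    rw [← Fintype.card_subtype, Fintype.card_congr (Equiv.sigmaSubtype b), Fintype.card_fin]
  simp only [hcard] at hv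
  rw [add_sub_cancel_left, Real.exp_log (by linarith)] at hv
  have hδ := max_mul_min_sum_le_one hm hr1
  rw [← hY] at hδ
  have hvar := variance_nonneg f (stdGaussian (EuclideanSpace ℝ ((Σ i : Fin k, Fin (M i)) × Fin N)))
  rw [← div_eq_mul_inv, le_div_iff₀ (by positivity)]
  -- The argument yields the factor `1 + log Y`; the stated `1 + (1/2) log Y` is smaller.
  nlinarith [mul_nonneg hvar hlog]
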